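/- **Theorem (MinSum pop-p, increases only, polynomial).** An instance of the capacitated house allocation problem consists of applicants $a_1,\dots,a_n$, houses $h_1,\dots,h_m$, for each applicant $a$ a strict preference order $\succ_a$ over her acceptable houses, and a positive integer capacity $q[h]$ for each house $h$. A matching assigns each applicant at most one house, which must be acceptable to her, such that each house $h$ receives at most $q[h]$ applicants; every applicant prefers any acceptable house to being unassigned. A matching $M$ is popular if there is no matching $M'$ such that more applicants prefer their outcome in $M'$ to that in $M$ than the other way around, and it is applicant-perfect if every applicant is assigned a house. A capacity increase vector is a vector $r$ of nonnegative integers indexed by the houses; it is good if the instance with capacities $q+r$ admits an applicant-perfect popular matching. Then the following problems are solvable in time polynomial in the size of the input (numbers written in binary): 1. given an instance and $k\in\mathbb{Z}_{\ge 0}$, decide whether there is a good capacity increase vector $r$ with $\sum_h r[h]\le k$; 2. given an instance, decide whether a good capacity increase vector exists and, if so, compute one, $r$, for which $\sum_h r[h]$ is minimum, together with an applicant-perfect popular matching for the capacities $q+r$. -/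

import Mathlib

/-! ## Random access machines with logarithmic cost

Programs are while-programs over a memory that consists of arrays of natural numbers.
The cost of a computation is logarithmic: producing or reading a number costs one unit
plus its binary length, so that running times are polynomially related to those of
Turing machines. -/

namespace RAM

/-- A memory: array number `a` holds the value `s a i` in cell `i`. A program is a finite
text, so it mentions only finitely many arrays. -/
abbrev Memory := ℕ → ℕ → ℕ

/-- Arithmetic expressions; `get a i` reads cell `i` of array `a`. -/
inductive Expr where
  | const (n : ℕ)
  | get (a : ℕ) (i : Expr)
  | add (e₁ e₂ : Expr)
  | sub (e₁ e₂ : Expr)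
  | mul (e₁ e₂ : Expr)

/-- The value of an expression (`sub` is truncated subtraction). -/
def Expr.eval (s : Memory) : Expr → ℕ
  | .const n => n
  | .get a i => s a (i.eval s)
  | .add e₁ e₂ => e₁.eval s + e₂.eval s
  | .sub e₁ e₂ => e₁.eval s - e₂.eval s
  | .mul e₁ e₂ => e₁.eval s * e₂.eval s

/-- The cost of evaluating an expression: every subexpression is charged one unit plus
the binary length of its value (for `get`, this includes the address). -/
def Expr.cost (s : Memory) : Expr → ℕ
  | .const n => n.size + 1
  | .get a i => i.cost s + (s a (i.eval s)).size + 1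
  | .add e₁ e₂ => e₁.cost s + e₂.cost s + (e₁.eval s + e₂.eval s).size + 1
  | .sub e₁ e₂ => e₁.cost s + e₂.cost s + (e₁.eval s - e₂.eval s).size + 1
  | .mul e₁ e₂ => e₁.cost s + e₂.cost s + (e₁.eval s * e₂.eval s).size + 1

/-- Programs. `assign a i e` stores the value of `e` in cell `i` of array `a`;
`cond e p q` runs `p` if `e` is nonzero and `q` otherwise;
`loop e p` repeats `p` as long as `e` is nonzero. -/
inductive Program where
  | skip
  | assign (a : ℕ) (i e : Expr)
  | seq (p q : Program)
  | cond (e : Expr) (p q : Program)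
  | loop (e : Expr) (p : Program)

/-- The memory after storing `v` in cell `i` of array `a`. -/
def Memory.set (s : Memory) (a i v : ℕ) : Memory :=
  Function.update s a (Function.update (s a) i v)

/-- `Run p s t s'`: started in memory `s`, the program `p` halts at cost `t`
in memory `s'`. -/
inductive Run : Program → Memory → ℕ → Memory → Prop where
  | skip (s : Memory) : Run .skip s 1 s
  | assign (s : Memory) (a : ℕ) (i e : Expr) :
      Run (.assign a i e) s (i.cost s + e.cost s + 1) (s.set a (i.eval s) (e.eval s))
  | seq {p q : Program} {s s' s'' : Memory} {t t' : ℕ} :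
      Run p s t s' → Run q s' t' s'' → Run (.seq p q) s (t + t') s''
  | cond_true {e : Expr} {p q : Program} {s s' : Memory} {t : ℕ} :
      e.eval s ≠ 0 → Run p s t s' → Run (.cond e p q) s (e.cost s + 1 + t) s'
  | cond_false {e : Expr} {p q : Program} {s s' : Memory} {t : ℕ} :
      e.eval s = 0 → Run q s t s' → Run (.cond e p q) s (e.cost s + 1 + t) s'
  | loop_done {e : Expr} {p : Program} {s : Memory} :
      e.eval s = 0 → Run (.loop e p) s (e.cost s + 1) s
  | loop_step {e : Expr} {p : Program} {s s' s'' : Memory} {t t' : ℕ} :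
      e.eval s ≠ 0 → Run p s t s' → Run (.loop e p) s' t' s'' →
        Run (.loop e p) s (e.cost s + 1 + t + t') s''

/-- The initial memory: the input words are in array `0`, all other cells are zero. -/
def init (w : List ℕ) : Memory := fun a i => if a = 0 then w.getD i 0 else 0

/-- The size of an input: the total binary length of its words, plus their number. -/
def inputSize (w : List ℕ) : ℕ := (w.map fun x => x.size + 1).sum

/-- The computational problem with inputs `x : X`, encoded by `enc`, and correctness
relation `R x out` between an input and the final content `out` of the output array
(array number `1`) is solvable in polynomial time: one program halts on every input with
a correct output, at a cost polynomial in the size of the input. -/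
def PolyTimeSolvable {X : Type} (enc : X → List ℕ) (R : X → (ℕ → ℕ) → Prop) : Prop :=
  ∃ (p : Program) (C d : ℕ), ∀ x : X, ∃ (t : ℕ) (s : Memory),
    Run p (init (enc x)) t s ∧ t ≤ C * (inputSize (enc x) + 1) ^ d ∧ R x (s 1)

/-- The decision problem `yes` is solvable in polynomial time: the answer,
`1` for yes and `0` for no, is left in the first cell of the output array. -/
def PolyTimeDecidable {X : Type} (enc : X → List ℕ) (yes : X → Prop) : Prop :=
  PolyTimeSolvable enc fun x out => (yes x → out 0 = 1) ∧ (¬ yes x → out 0 = 0)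

end RAM

/-! ## House allocation with capacitated houses -/

/-- An instance of the capacitated house allocation problem: `n` applicants, `m` houses,
for each applicant the list of her acceptable houses in order of strictly decreasing
preference, and a positive capacity for each house. -/
structure HouseInstance where
  n : ℕ
  m : ℕ
  pref : Fin n → List (Fin m)
  pref_nodup : ∀ a, (pref a).Nodup
  cap : Fin m → ℕ
  cap_pos : ∀ h, 0 < cap h

namespace HouseInstance

/-- The instance with capacities `q + r`, where `r ≥ 0` is a capacity increase vector. -/
def increase (I : HouseInstance) (r : Fin I.m → ℕ) : HouseInstance where
  n := I.n
  m := I.m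
  pref := I.pref
  pref_nodup := I.pref_nodup
  cap := fun h => I.cap h + r h
  cap_pos := fun h => Nat.add_pos_left (I.cap_pos h) (r h)

/-- An assignment of at most one house to each applicant (`none`: unassigned). -/
abbrev Assignment (I : HouseInstance) := Fin I.n → Option (Fin I.m)

/-- Matchings: applicants are only assigned acceptable houses, and no house is assigned
to more applicants than its capacity. -/
def IsMatching (I : HouseInstance) (M : I.Assignment) : Prop :=
  (∀ a h, M a = some h → h ∈ I.pref a) ∧
    ∀ h, (Finset.univ.filter fun a => M a = some h).card ≤ I.cap h

/-- Applicant `a` prefers the outcome `x` to the outcome `y`: acceptable houses are compared by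
their position on her list, and any house is better than being unassigned. -/
def Prefers (I : HouseInstance) (a : Fin I.n) : Option (Fin I.m) → Option (Fin I.m) → Prop
  | some h, some h' => (I.pref a).idxOf h < (I.pref a).idxOf h'
  | some _, none => True
  | none, _ => False

open Classical in
/-- The vote of applicant `a` between `M` and `M'`. -/
noncomputable def voteOf (I : HouseInstance) (M M' : I.Assignment) (a : Fin I.n) : ℤ :=
  if M a = M' a then 0 else if I.Prefers a (M a) (M' a) then 1 else -1

/-- The total vote between `M` and `M'`. -/
noncomputable def vote (I : HouseInstance) (M M' : I.Assignment) : ℤ :=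
  ∑ a, I.voteOf M M' a

/-- `M` is a popular matching: it is a matching and loses against no matching. -/
def IsPopular (I : HouseInstance) (M : I.Assignment) : Prop :=
  I.IsMatching M ∧ ∀ M' : I.Assignment, I.IsMatching M' → ¬ I.vote M M' < 0

/-- `M` is applicant-perfect: every applicant is assigned a house. -/
def IsPerfect (I : HouseInstance) (M : I.Assignment) : Prop := ∀ a, ∃ h, M a = some h

/-- `r` is a good capacity increase vector: with capacities `q + r` there is an
applicant-perfect popular matching. -/
def IsGoodIncrease (I : HouseInstance) (r : Fin I.m → ℕ) : Prop :=
  ∃ M : (I.increase r).Assignment, (I.increase r).IsPopular M ∧ (I.increase r).IsPerfect M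

/-- The input words of an instance: the numbers of applicants and houses, the capacities, and for
each applicant the length of her preference list followed by its entries. -/
def encode (I : HouseInstance) : List ℕ :=
  [I.n, I.m] ++ List.ofFn I.cap ++
    (List.ofFn fun a => (I.pref a).length :: (I.pref a).map Fin.val).flatten

/-- The decision problem, for an instance and a bound `k`: is there a good capacity increase
vector of total at most `k`? -/
def MinSumPopP (x : HouseInstance × ℕ) : Prop :=
  ∃ r : Fin x.1.m → ℕ, ∑ h, r h ≤ x.2 ∧ x.1.IsGoodIncrease r

/-- `out` is a correct answer to the optimisation problem on the instance `I`. Either there is no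
good capacity increase vector and the output starts with `0`; or the output starts with `1`,
followed by a good capacity increase vector `r` whose total is minimum and by an applicant-perfect
popular matching `M` for the capacities `q + r` (the house of each applicant). -/
def IsMinSumSolution (I : HouseInstance) (out : ℕ → ℕ) : Prop :=
  ((∀ r, ¬ I.IsGoodIncrease r) ∧ out 0 = 0) ∨
    (out 0 = 1 ∧ ∃ (r : Fin I.m → ℕ) (M : Fin I.n → Fin I.m),
      (∀ h : Fin I.m, out (1 + h) = r h) ∧ (∀ a : Fin I.n, out (1 + I.m + a) = M a) ∧
      (I.increase r).IsPopular (fun a => some (M a)) ∧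
      ∀ r', I.IsGoodIncrease r' → ∑ h, r h ≤ ∑ h, r' h)

end HouseInstance

/-! Write f(a) for the first house of applicant a, and s(a) for her best house with more places than
first-choosers. In a popular matching, a house that somebody prefers to her own outcome is full
(`IsPopular.cap_le`) and holds only its own first-choosers (`IsPopular.first_eq`), since otherwise a
deviation of at most three applicants would win. So a house with room for its first-choosers gets
all of them, and nobody prefers a house with more places than first-choosers. Conversely, sending
everybody to f(a) or s(a) is popular if every house with at least as many first-choosers as places
is filled to capacity (`isPopular_of_full`).

The algorithm computes f and s for the original capacities q and starts with everyone in f(a). An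
applicant whose first house is overloaded may move between f(a) and s(a). As long as a chain of such
moves leads from an overloaded house to one with a free place, the chain is carried out; the total
overload falls by one, so at most n rounds are needed. The final assignment g yields the increase
(load of g) - q, truncated at zero, and is popular for it (`isPopular_increase`).

Minimality is a cut argument (`sum_le_of_isGoodIncrease`). Let Z be the set of houses reachable from
the overloaded ones; no house of Z has a free place. The difficulty is that a competing increase r
may create new second houses. Let N consist of the houses outside Z that have at least q but fewer
than q + r first-choosers. A popular matching for q + r sends the applicants whom g puts in Z into
the union of Z and N, and keeps the first-choosers of N in N. As the latter already use up the old
places of N, the total of r is at least the overload of Z, which is the whole overload of g. If some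
list is empty there is no good increase; otherwise g shows that one exists.

For the running time, programs are written in a language whose loops all run n + m times and which
has no multiplication. A fixed program then takes polynomially many steps, and each step adds only a
bounded number of bits (`Code.run_compile`). The number n + m is at most the number of input words,
so the logarithmic cost is polynomial (`polyTimeSolvable_of_code`). -/

namespace RAM

/-! ### Bounded-loop programs and their logarithmic cost. -/

/-- Expressions without multiplication. -/
def Expr.mulFree : Expr → Bool
  | .const _ => true
  | .get _ i => i.mulFree
  | .add e₁ e₂ => e₁.mulFree && e₂.mulFree
  | .sub e₁ e₂ => e₁.mulFree && e₂.mulFree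
  | .mul _ _ => false

/-- A measure of the length of an expression. -/
def Expr.weight : Expr → ℕ
  | .const n => n.size + 1
  | .get _ i => i.weight + 1
  | .add e₁ e₂ => e₁.weight + e₂.weight + 1
  | .sub e₁ e₂ => e₁.weight + e₂.weight + 1
  | .mul e₁ e₂ => e₁.weight + e₂.weight + 1

/-- All cells of the memory hold numbers of at most `B` bits. -/
def Memory.Bounded (B : ℕ) (s : Memory) : Prop := ∀ a i, s a i < 2 ^ B

theorem Memory.Bounded.mono {B B' : ℕ} {s : Memory} (h : s.Bounded B) (hB : B ≤ B') :
    s.Bounded B' :=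
  fun a i => (h a i).trans_le (Nat.pow_le_pow_right (by norm_num) hB)

@[simp] theorem Memory.set_same (s : Memory) (a i v : ℕ) :
    s.set a i v a = Function.update (s a) i v := by
  simp [Memory.set]

theorem Memory.set_ne (s : Memory) {a b : ℕ} (i v : ℕ) (h : b ≠ a) : s.set a i v b = s b := by
  simp [Memory.set, h]

theorem Memory.Bounded.set {B : ℕ} {s : Memory} (h : s.Bounded B) (a i : ℕ) {v : ℕ}
    (hv : v < 2 ^ B) : (s.set a i v).Bounded B := by
  intro b j
  by_cases hb : b = a
  · subst hb
    rw [Memory.set_same]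
    by_cases hj : j = i
    · subst hj; simpa using hv
    · simpa [hj] using h b j
  · rw [Memory.set_ne _ _ _ hb]
    exact h b j

/-- An addition lengthens its longer operand by at most one bit, so lengths grow additively with the
weight. Repeated squaring would destroy this, which is why products are excluded. -/
theorem Expr.eval_lt {B : ℕ} {s : Memory} (h : s.Bounded B) :
    ∀ e : Expr, e.mulFree → e.eval s < 2 ^ (B + e.weight)
  | .const n, _ => by
      refine (Nat.lt_size_self n).trans_le (Nat.pow_le_pow_right (by norm_num) ?_)
      simp only [Expr.weight]; omega
  | .get a i, _ => (h _ _).trans_le (Nat.pow_le_pow_right (by norm_num) (by omega))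
  | .add e₁ e₂, hm => by
      simp only [Expr.mulFree, Bool.and_eq_true] at hm
      have h₁ : e₁.eval s < 2 ^ (B + (e₁.weight + e₂.weight)) :=
        (e₁.eval_lt h hm.1).trans_le (Nat.pow_le_pow_right (by norm_num) (by omega))
      have h₂ : e₂.eval s < 2 ^ (B + (e₁.weight + e₂.weight)) :=
        (e₂.eval_lt h hm.2).trans_le (Nat.pow_le_pow_right (by norm_num) (by omega))
      simp only [Expr.eval, Expr.weight, ← Nat.add_assoc, pow_succ] at *
      omega
  | .sub e₁ e₂, hm => by
      simp only [Expr.mulFree, Bool.and_eq_true] at hm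
      refine (Nat.sub_le _ _).trans_lt ((e₁.eval_lt h hm.1).trans_le ?_)
      refine Nat.pow_le_pow_right (by norm_num) ?_
      simp only [Expr.weight]; omega
  | .mul _ _, hm => by simp [Expr.mulFree] at hm

theorem Expr.cost_le {B : ℕ} {s : Memory} (h : s.Bounded B) :
    ∀ e : Expr, e.mulFree → e.cost s ≤ e.weight * (B + e.weight + 1)
  | .const n, _ => by
      simp only [Expr.cost, Expr.weight]; nlinarith
  | .get a i, hm => by
      have h₁ := i.cost_le h hm
      have h₂ : (s a (i.eval s)).size ≤ B := Nat.size_le.2 (h _ _)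
      simp only [Expr.cost, Expr.weight]; nlinarith
  | .add e₁ e₂, hm => by
      have h₃ := Nat.size_le.2 ((Expr.add e₁ e₂).eval_lt h hm)
      simp only [Expr.mulFree, Bool.and_eq_true] at hm
      have h₁ := e₁.cost_le h hm.1
      have h₂ := e₂.cost_le h hm.2
      simp only [Expr.cost, Expr.weight, Expr.eval] at *; nlinarith
  | .sub e₁ e₂, hm => by
      have h₃ := Nat.size_le.2 ((Expr.sub e₁ e₂).eval_lt h hm)
      simp only [Expr.mulFree, Bool.and_eq_true] at hm
      have h₁ := e₁.cost_le h hm.1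
      have h₂ := e₂.cost_le h hm.2
      simp only [Expr.cost, Expr.weight, Expr.eval] at *; nlinarith
  | .mul _ _, hm => by simp [Expr.mulFree] at hm

/-- Programs with bounded loops: `rep v p` runs `p` with the loop counter, cell `0` of array `v`,
ranging over the numbers below the content of cell `0` of array `2`. -/
inductive Code where
  | skip
  | assign (a : ℕ) (i e : Expr)
  | seq (p q : Code)
  | cond (e : Expr) (p q : Code)
  | rep (v : ℕ) (p : Code)

namespace Code

/-- The effect of a program on the memory. -/
def den : Code → Memory → Memory
  | skip, s => s
  | assign a i e, s => s.set a (i.eval s) (e.eval s)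
  | seq p q, s => q.den (p.den s)
  | cond e p q, s => if e.eval s = 0 then q.den s else p.den s
  | rep v p, s => (fun s' => (p.den s').set v 0 (s' v 0 + 1))^[s 2 0] (s.set v 0 0)

/-- The while-program that executes a program with bounded loops. -/
def compile : Code → Program
  | skip => .skip
  | assign a i e => .assign a i e
  | seq p q => .seq p.compile q.compile
  | cond e p q => .cond e p.compile q.compile
  | rep v p => .seq (.assign v (.const 0) (.const 0))
      (.loop (.sub (.get 2 (.const 0)) (.get v (.const 0)))
        (.seq p.compile (.assign v (.const 0) (.add (.get v (.const 0)) (.const 1)))))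

/-- The program does not write to array `b`. -/
def keeps (b : ℕ) : Code → Bool
  | skip => true
  | assign a _ _ => a != b
  | seq p q => p.keeps b && q.keeps b
  | cond _ p q => p.keeps b && q.keeps b
  | rep v p => v != b && p.keeps b

/-- The program does not multiply, and respects the loop counters and array `2`. -/
def ok : Code → Bool
  | skip => true
  | assign a i e => a != 2 && i.mulFree && e.mulFree
  | seq p q => p.ok && q.ok
  | cond e p q => e.mulFree && p.ok && q.ok
  | rep v p => v != 2 && p.keeps v && p.ok

/-- A bound for the number of steps if all loops are repeated `L` times. -/
def steps (L : ℕ) : Code → ℕ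
  | skip => 1
  | assign _ i e => i.weight + e.weight + 1
  | seq p q => p.steps L + q.steps L
  | cond e p q => e.weight + 1 + (p.steps L + q.steps L)
  | rep _ p => 10 + L * (p.steps L + 20)

/-- The frame rule. Because `keeps` is a computable Boolean, its hypotheses are discharged by `rfl`
for concrete programs. -/
theorem den_of_keeps {b : ℕ} : ∀ {p : Code}, p.keeps b → ∀ s, p.den s b = s b
  | skip, _, _ => rfl
  | assign a i e, h, s => by
      simp only [keeps, bne_iff_ne, ne_eq] at h
      exact Memory.set_ne _ _ _ (Ne.symm h)
  | seq p q, h, s => by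
      simp only [keeps, Bool.and_eq_true] at h
      rw [den, den_of_keeps h.2, den_of_keeps h.1]
  | cond e p q, h, s => by
      simp only [keeps, Bool.and_eq_true] at h
      rw [den]
      split_ifs
      exacts [den_of_keeps h.2 s, den_of_keeps h.1 s]
  | rep v p, h, s => by
      simp only [keeps, Bool.and_eq_true, bne_iff_ne, ne_eq] at h
      have key : ∀ k, ((fun s' => (p.den s').set v 0 (s' v 0 + 1))^[k] (s.set v 0 0)) b = s b := by
        intro k
        induction k with
        | zero => exact Memory.set_ne _ _ _ (Ne.symm h.1)
        | succ k ih =>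
          rw [Function.iterate_succ_apply', Memory.set_ne _ _ _ (Ne.symm h.1),
            den_of_keeps h.2, ih]
      exact key _

theorem keeps_two_of_ok : ∀ {p : Code}, p.ok → p.keeps 2
  | skip, _ => rfl
  | assign a i e, h => by
      simp only [ok, Bool.and_eq_true] at h
      exact h.1.1
  | seq p q, h => by
      simp only [ok, Bool.and_eq_true] at h
      simp [keeps, keeps_two_of_ok h.1, keeps_two_of_ok h.2]
  | cond e p q, h => by
      simp only [ok, Bool.and_eq_true] at h
      simp [keeps, keeps_two_of_ok h.1.2, keeps_two_of_ok h.2]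
  | rep v p, h => by
      simp only [ok, Bool.and_eq_true] at h
      simp [keeps, keeps_two_of_ok h.2, h.1.1]

/-- Execution of a loop whose counter stands at `j`, with `k` rounds to go. -/
theorem run_loop {v : ℕ} {p : Code} (hv : v ≠ 2) (hk : p.keeps v) (h2 : p.keeps 2) {L K : ℕ}
    (hp : ∀ (s : Memory) (B : ℕ), s 2 0 = L → s.Bounded B → ∃ t, Run p.compile s t (p.den s) ∧
      t ≤ K * (B + K + 1) ∧ (p.den s).Bounded (B + K)) :
    ∀ (k j : ℕ) (s : Memory) (B : ℕ), s 2 0 = L → s.Bounded B → s v 0 = j → j + k = L →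
      ∃ t, Run (.loop (.sub (.get 2 (.const 0)) (.get v (.const 0)))
          (.seq p.compile (.assign v (.const 0) (.add (.get v (.const 0)) (.const 1))))) s t
          ((fun s' => (p.den s').set v 0 (s' v 0 + 1))^[k] s) ∧
        t ≤ (6 + k * (K + 20)) * (B + (6 + k * (K + 20)) + 1) ∧
        ((fun s' => (p.den s').set v 0 (s' v 0 + 1))^[k] s).Bounded (B + k * (K + 20)) := by
  intro k
  induction k with
  | zero =>
    intro j s B hL hB hj hjk
    have he : (Expr.sub (.get 2 (.const 0)) (.get v (.const 0))).eval s = 0 := by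
      simp [Expr.eval, hL, hj]; omega
    have hc := Expr.cost_le hB (.sub (.get 2 (.const 0)) (.get v (.const 0))) rfl
    have hw : (Expr.sub (.get 2 (.const 0)) (.get v (.const 0))).weight = 5 := rfl
    rw [hw] at hc
    refine ⟨_, Run.loop_done he, ?_, ?_⟩
    · refine (Nat.add_le_add_right hc 1).trans ?_
      nlinarith
    · simpa using hB
  | succ k ih =>
    intro j s B hL hB hj hjk
    have he : (Expr.sub (.get 2 (.const 0)) (.get v (.const 0))).eval s ≠ 0 := by
      simp [Expr.eval, hL, hj]; omega
    have hc := Expr.cost_le hB (.sub (.get 2 (.const 0)) (.get v (.const 0))) rfl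
    have hw : (Expr.sub (.get 2 (.const 0)) (.get v (.const 0))).weight = 5 := rfl
    rw [hw] at hc
    obtain ⟨t₁, hr₁, ht₁, hb₁⟩ := hp s B hL hB
    have hv₁ : p.den s v = s v := den_of_keeps hk s
    have h2₁ : p.den s 2 = s 2 := den_of_keeps h2 s
    have hr₂ := Run.assign (p.den s) v (.const 0) (.add (.get v (.const 0)) (.const 1))
    have hc₂ := Expr.cost_le hb₁ (.const 0) rfl
    have hc₃ := Expr.cost_le hb₁ (.add (.get v (.const 0)) (.const 1)) rfl
    have he₃ := Expr.eval_lt hb₁ (.add (.get v (.const 0)) (.const 1)) rfl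
    have hw₂ : (Expr.const 0).weight = 1 := rfl
    have hw₃ : (Expr.add (.get v (.const 0)) (.const 1)).weight = 5 := rfl
    rw [hw₂] at hc₂
    rw [hw₃] at hc₃ he₃
    -- The summand 20 per round is slack for the loop test and the counter update, each with an
    -- expression of weight 5.
    have hb₂ : ((p.den s).set v 0 (s v 0 + 1)).Bounded (B + (K + 20)) := by
      refine (hb₁.mono (by omega)).set _ _ ?_
      have : (Expr.add (.get v (.const 0)) (.const 1)).eval (p.den s) = s v 0 + 1 := by
        simp [Expr.eval, hv₁]
      rw [← this]
      exact he₃.trans_le (Nat.pow_le_pow_right (by norm_num) (by omega))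
    have hset : (p.den s).set v ((Expr.const 0).eval (p.den s))
        ((Expr.add (.get v (.const 0)) (.const 1)).eval (p.den s))
        = (p.den s).set v 0 (s v 0 + 1) := by
      simp [Expr.eval, hv₁]
    rw [hset] at hr₂
    obtain ⟨t₃, hr₃, ht₃, hb₃⟩ := ih (j + 1) ((p.den s).set v 0 (s v 0 + 1)) (B + (K + 20))
      (by rw [Memory.set_ne _ _ _ (Ne.symm hv), h2₁, hL]) hb₂ (by simp [hj]) (by omega)
    refine ⟨_, Run.loop_step he (Run.seq hr₁ hr₂) hr₃, ?_, ?_⟩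
    · generalize hX : k * (K + 20) = X at *
      have hk1 : (k + 1) * (K + 20) = X + (K + 20) := by rw [← hX]; ring
      rw [hk1]
      nlinarith
    · refine Memory.Bounded.mono hb₃ ?_
      rw [Nat.add_mul]; omega

/-- Time K(B + K + 1) together with final length B + K is a form that survives composition: K₁(B +
K₁ + 1) + K₂(B + K₁ + K₂ + 1) is at most the same expression for K₁ + K₂. Array `2` is never
written, so every loop has the same length L. -/
theorem run_compile {L : ℕ} : ∀ (p : Code), p.ok → ∀ (s : Memory) (B : ℕ), s 2 0 = L →
    s.Bounded B → ∃ t, Run p.compile s t (p.den s) ∧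
      t ≤ p.steps L * (B + p.steps L + 1) ∧ (p.den s).Bounded (B + p.steps L)
  | skip, _, s, B, _, hB => by
      refine ⟨1, .skip s, ?_, hB.mono (by simp [steps])⟩
      simp only [steps]; omega
  | assign a i e, h, s, B, _, hB => by
      simp only [ok, Bool.and_eq_true] at h
      refine ⟨_, .assign s a i e, ?_, ?_⟩
      · have h₁ := i.cost_le hB h.1.2
        have h₂ := e.cost_le hB h.2
        simp only [steps]; nlinarith
      · refine (hB.mono (by omega)).set _ _ ((e.eval_lt hB h.2).trans_le ?_)
        exact Nat.pow_le_pow_right (by norm_num) (by simp only [steps]; omega)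
  | seq p q, h, s, B, hL, hB => by
      simp only [ok, Bool.and_eq_true] at h
      obtain ⟨t₁, hr₁, ht₁, hb₁⟩ := run_compile p h.1 s B hL hB
      obtain ⟨t₂, hr₂, ht₂, hb₂⟩ := run_compile q h.2 (p.den s) _
        (by rw [den_of_keeps (keeps_two_of_ok h.1), hL]) hb₁
      refine ⟨_, .seq hr₁ hr₂, ?_, hb₂.mono (by simp only [steps]; omega)⟩
      simp only [steps]; nlinarith
  | cond e p q, h, s, B, hL, hB => by
      simp only [ok, Bool.and_eq_true] at h
      have hc := e.cost_le hB h.1.1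
      by_cases he : e.eval s = 0
      · obtain ⟨t, hr, ht, hb⟩ := run_compile q h.2 s B hL hB
        rw [den, if_pos he]
        refine ⟨_, .cond_false he hr, ?_, hb.mono (by simp only [steps]; omega)⟩
        simp only [steps]; nlinarith
      · obtain ⟨t, hr, ht, hb⟩ := run_compile p h.1.2 s B hL hB
        rw [den, if_neg he]
        refine ⟨_, .cond_true he hr, ?_, hb.mono (by simp only [steps]; omega)⟩
        simp only [steps]; nlinarith
  | rep v p, h, s, B, hL, hB => by
      simp only [ok, Bool.and_eq_true, bne_iff_ne, ne_eq] at h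
      have hs : s.set v 0 0 2 0 = L := by rw [Memory.set_ne _ _ _ (Ne.symm h.1.1), hL]
      have hr₁ := Run.assign s v (.const 0) (.const 0)
      have hc := Expr.cost_le hB (.const 0) rfl
      have hw : (Expr.const 0).weight = 1 := rfl
      rw [hw] at hc
      obtain ⟨t, hr, ht, hb⟩ := run_loop h.1.1 h.1.2 (keeps_two_of_ok h.2)
        (run_compile p h.2) L 0 (s.set v 0 0) B hs (hB.set _ _ (by positivity)) (by simp)
        (by omega)
      simp only [den, hL]
      refine ⟨_, .seq hr₁ hr, ?_, hb.mono (by simp only [steps]; omega)⟩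
      simp only [steps]
      generalize L * (p.steps L + 20) = X at *
      nlinarith

/-- Each loop raises the degree by one, so the degree depends only on the program text. -/
theorem steps_le : ∀ p : Code, ∃ C d, ∀ L, p.steps L ≤ C * (L + 1) ^ d
  | skip => ⟨1, 0, fun L => by simp [steps]⟩
  | assign a i e => ⟨i.weight + e.weight + 1, 0, fun L => by simp [steps]⟩
  | seq p q => by
      obtain ⟨C, d, h⟩ := steps_le p
      obtain ⟨C', d', h'⟩ := steps_le q
      refine ⟨C + C', d + d', fun L => ?_⟩
      have h₁ : (L + 1) ^ d ≤ (L + 1) ^ (d + d') := Nat.pow_le_pow_right (by omega) (by omega)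
      have h₂ : (L + 1) ^ d' ≤ (L + 1) ^ (d + d') := Nat.pow_le_pow_right (by omega) (by omega)
      have := h L
      have := h' L
      simp only [steps]
      nlinarith [Nat.mul_le_mul_left C h₁, Nat.mul_le_mul_left C' h₂]
  | cond e p q => by
      obtain ⟨C, d, h⟩ := steps_le p
      obtain ⟨C', d', h'⟩ := steps_le q
      refine ⟨e.weight + 1 + (C + C'), d + d', fun L => ?_⟩
      have h₁ : (L + 1) ^ d ≤ (L + 1) ^ (d + d') := Nat.pow_le_pow_right (by omega) (by omega)
      have h₂ : (L + 1) ^ d' ≤ (L + 1) ^ (d + d') := Nat.pow_le_pow_right (by omega) (by omega)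
      have h₃ : 1 ≤ (L + 1) ^ (d + d') := Nat.one_le_pow _ _ (by omega)
      have := h L
      have := h' L
      simp only [steps]
      nlinarith [Nat.mul_le_mul_left C h₁, Nat.mul_le_mul_left C' h₂,
        Nat.mul_le_mul_left (e.weight + 1) h₃]
  | rep v p => by
      obtain ⟨C, d, h⟩ := steps_le p
      refine ⟨C + 30, d + 1, fun L => ?_⟩
      have h₃ : 1 ≤ (L + 1) ^ d := Nat.one_le_pow _ _ (by omega)
      have := h L
      simp only [steps, pow_succ]
      generalize (L + 1) ^ d = X at *
      have h₄ : L * (p.steps L + 20) ≤ L * (C * X + 20 * X) := Nat.mul_le_mul_left _ (by omega)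
      nlinarith

/-- A loop invariant. -/
theorem den_rep_induction {v : ℕ} {p : Code} (s : Memory) (P : ℕ → Memory → Prop)
    (h0 : P 0 (s.set v 0 0))
    (hs : ∀ i < s 2 0, ∀ s', (∀ b, (rep v p).keeps b → s' b = s b) → s' v 0 = i → P i s' →
      P (i + 1) ((p.den s').set v 0 (i + 1))) :
    P (s 2 0) ((rep v p).den s) := by
  -- The induction also carries the counter value and the unchanged arrays, so that invariants need
  -- not mention them.
  have key : ∀ k ≤ s 2 0, P k ((fun s' => (p.den s').set v 0 (s' v 0 + 1))^[k] (s.set v 0 0)) ∧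
      ((fun s' => (p.den s').set v 0 (s' v 0 + 1))^[k] (s.set v 0 0)) v 0 = k ∧
      ∀ b, (rep v p).keeps b →
        ((fun s' => (p.den s').set v 0 (s' v 0 + 1))^[k] (s.set v 0 0)) b = s b := by
    intro k
    induction k with
    | zero =>
      refine fun _ => ⟨h0, by simp, fun b hb => ?_⟩
      simp only [keeps, Bool.and_eq_true, bne_iff_ne, ne_eq] at hb
      exact Memory.set_ne _ _ _ (Ne.symm hb.1)
    | succ k ih =>
      intro hk
      obtain ⟨h₁, h₂, h₃⟩ := ih (by omega)
      rw [Function.iterate_succ_apply', h₂]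
      refine ⟨hs k (by omega) _ h₃ h₂ h₁, by simp, fun b hb => ?_⟩
      have hb' := hb
      simp only [keeps, Bool.and_eq_true, bne_iff_ne, ne_eq] at hb'
      rw [Memory.set_ne _ _ _ (Ne.symm hb'.1), den_of_keeps hb'.2, h₃ b hb]
  exact (key _ le_rfl).1

end Code

/-! ### From bounded loops to polynomial time. -/

/-- The initial memory, except that cell `0` of array `2` holds the sum of the input words at the
positions `off` and `off + 1`. -/
def start (off : ℕ) (w : List ℕ) : Memory :=
  (init w).set 2 0 (w.getD off 0 + w.getD (off + 1) 0)

theorem init_bounded (w : List ℕ) : (init w).Bounded (inputSize w) := by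
  intro a i
  simp only [init]
  split_ifs
  · by_cases hi : i < w.length
    · rw [List.getD_eq_getElem _ _ hi]
      refine (Nat.lt_size_self _).trans_le (Nat.pow_le_pow_right (by norm_num) ?_)
      have : (w[i].size + 1) ∈ w.map fun x => x.size + 1 :=
        List.mem_map.2 ⟨w[i], List.getElem_mem hi, rfl⟩
      have := List.le_sum_of_mem this
      simp only [inputSize]; omega
    · rw [List.getD_eq_default _ _ (by omega)]
      positivity
  · positivity

theorem length_le_inputSize (w : List ℕ) : w.length ≤ inputSize w := by
  induction w with
  | nil => simp
  | cons x w ih => simp only [inputSize, List.length_cons, List.map_cons, List.sum_cons] at *; omega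

/-- A program with bounded loops solves a problem in polynomial time if the number of repetitions
is at most the size of the input. -/
theorem polyTimeSolvable_of_code {X : Type} {enc : X → List ℕ} {R : X → (ℕ → ℕ) → Prop}
    (p : Code) (hp : p.ok) (off : ℕ)
    (hL : ∀ x, (enc x).getD off 0 + (enc x).getD (off + 1) 0 ≤ inputSize (enc x))
    (hR : ∀ x, R x (p.den (start off (enc x)) 1)) : PolyTimeSolvable enc R := by
  obtain ⟨C, d, hC⟩ := p.steps_le
  let e : Expr := .add (.get 0 (.const off)) (.get 0 (.const (off + 1)))
  let W := e.weight
  refine ⟨.seq (.assign 2 (.const 0) e) p.compile, (1 + W + 1) * (1 + W + 2) + C * (W + C + 2),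
    2 * d + 1, fun x => ?_⟩
  set w := enc x
  set N := inputSize w
  have hb := init_bounded w
  have he : e.eval (init w) = w.getD off 0 + w.getD (off + 1) 0 := by
    simp [e, Expr.eval, init]
  have hset : (init w).set 2 ((Expr.const 0).eval (init w)) (e.eval (init w)) = start off w := by
    rw [he]; rfl
  have hr₁ := Run.assign (init w) 2 (.const 0) e
  have hc₁ := Expr.cost_le hb (.const 0) rfl
  have hw : (Expr.const 0).weight = 1 := rfl
  rw [hw] at hc₁
  have hc₂ := Expr.cost_le hb e rfl
  rw [hset] at hr₁
  have hb' : (start off w).Bounded (N + W) := by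
    refine (hb.mono (by omega)).set _ _ ?_
    rw [← he]
    exact Expr.eval_lt hb e rfl
  obtain ⟨t, hr, ht, -⟩ := Code.run_compile p hp (start off w) (N + W) rfl hb'
  refine ⟨_, _, .seq hr₁ hr, ?_, hR x⟩
  have hs2 : start off w 2 0 ≤ N := by
    have := hL x
    simpa [start, Memory.set] using this
  set S := p.steps (start off w 2 0)
  have hS : S ≤ C * (N + 1) ^ d := (hC _).trans (by gcongr)
  have h1 : 1 ≤ (N + 1) ^ d := Nat.one_le_pow _ _ (by omega)
  have hpow : (N + 1) ^ (2 * d + 1) = (N + 1) ^ d * (N + 1) ^ d * (N + 1) := by ring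
  rw [hpow]
  change _ ≤ W * (N + W + 1) at hc₂
  generalize (N + 1) ^ d = Y at *
  have hA : (Expr.const 0).cost (init w) + e.cost (init w) + 1 ≤
      (1 + W + 1) * (1 + W + 2) * (N + 1) := by
    nlinarith [Nat.zero_le (N * W), Nat.zero_le (N * W * W)]
  have hY : N + 1 ≤ Y * Y * (N + 1) := by nlinarith [Nat.mul_le_mul h1 h1]
  -- The program makes at most C·Y steps on cells of at most N + W bits; the product of the two
  -- factors in its cost accounts for the degree 2d + 1. The other summand of the constant pays for
  -- storing the loop bound.
  have hB : t ≤ C * (W + C + 2) * (Y * Y * (N + 1)) := by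
    refine ht.trans ?_
    have h3 : N + W + S + 1 ≤ (W + C + 2) * (Y * (N + 1)) := by
      have a1 : N + 1 ≤ Y * (N + 1) := by nlinarith
      have a2 : W ≤ W * (Y * (N + 1)) := by
        have : 1 ≤ Y * (N + 1) := by omega
        nlinarith
      have a3 : C * Y ≤ C * (Y * (N + 1)) := Nat.mul_le_mul_left _ (by nlinarith)
      nlinarith
    calc S * (N + W + S + 1) ≤ (C * Y) * ((W + C + 2) * (Y * (N + 1))) := Nat.mul_le_mul hS h3
      _ = _ := by ring
  calc _ ≤ (1 + W + 1) * (1 + W + 2) * (Y * Y * (N + 1)) + C * (W + C + 2) * (Y * Y * (N + 1)) :=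
        Nat.add_le_add (hA.trans (Nat.mul_le_mul_left _ hY)) hB
    _ = _ := by ring

end RAM

/-! ### Structure of popular matchings. -/

namespace HouseInstance

/-- The number of applicants that `g` sends to the house `h`. -/
def load {n m : ℕ} (g : Fin n → Fin m) (h : Fin m) : ℕ :=
  (Finset.univ.filter fun a => g a = h).card

/-- `f` maps each applicant to the first house on her list. -/
def IsFirst (I : HouseInstance) (f : Fin I.n → Fin I.m) : Prop :=
  ∀ a, (I.pref a).head? = some (f a)

variable {I : HouseInstance} {f : Fin I.n → Fin I.m}

theorem IsFirst.mem (hf : I.IsFirst f) (a : Fin I.n) : f a ∈ I.pref a :=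
  List.mem_of_mem_head? (hf a)

theorem IsFirst.idxOf_lt (hf : I.IsFirst f) {a : Fin I.n} {h : Fin I.m} (hne : h ≠ f a) :
    (I.pref a).idxOf (f a) < (I.pref a).idxOf h := by
  have h₁ := hf a
  cases hl : I.pref a with
  | nil => simp [hl] at h₁
  | cons x l =>
    rw [hl] at h₁
    simp only [List.head?_cons, Option.some.injEq] at h₁
    subst h₁
    rw [List.idxOf_cons_self, List.idxOf_cons_ne _ (Ne.symm hne)]
    omega

theorem IsFirst.prefers (hf : I.IsFirst f) {a : Fin I.n} {x : Option (Fin I.m)}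
    (hx : x ≠ some (f a)) : I.Prefers a (some (f a)) x := by
  cases x with
  | none => trivial
  | some h => exact hf.idxOf_lt fun e => hx (by rw [e])

theorem voteOf_of_prefers {M M' : I.Assignment} {a : Fin I.n} (h : I.Prefers a (M a) (M' a)) :
    I.voteOf M M' a = 1 := by
  have hne : M a ≠ M' a := by
    intro e
    rw [← e] at h
    cases hM : M a with
    | none => rw [hM] at h; exact h
    | some k => rw [hM] at h; exact lt_irrefl _ h
  simp [voteOf, hne, h]

theorem voteOf_of_prefers' {M M' : I.Assignment} {a : Fin I.n} (h : I.Prefers a (M' a) (M a)) :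
    I.voteOf M M' a = -1 := by
  have hne : M a ≠ M' a ∧ ¬ I.Prefers a (M a) (M' a) := by
    cases hM : M a <;> cases hM' : M' a <;> rw [hM, hM'] at h
    · exact absurd h id
    · exact ⟨by simp, id⟩
    · exact absurd h id
    · refine ⟨?_, not_lt_of_gt h⟩
      rintro ⟨⟩
      exact lt_irrefl _ h
  simp [voteOf, hne]

theorem voteOf_le_one (M M' : I.Assignment) (a : Fin I.n) : I.voteOf M M' a ≤ 1 := by
  unfold voteOf; split_ifs <;> norm_num

theorem neg_one_le_voteOf (M M' : I.Assignment) (a : Fin I.n) : -1 ≤ I.voteOf M M' a := by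
  unfold voteOf; split_ifs <;> norm_num

theorem voteOf_of_eq {M M' : I.Assignment} {a : Fin I.n} (h : M a = M' a) :
    I.voteOf M M' a = 0 := by
  simp [voteOf, h]

/-- In a popular matching, no applicant prefers a house with a free place. -/
theorem IsPopular.cap_le {M : I.Assignment} (hM : I.IsPopular M) {a : Fin I.n} {h : Fin I.m}
    (hh : h ∈ I.pref a) (hp : I.Prefers a (some h) (M a)) :
    I.cap h ≤ (Finset.univ.filter fun x => M x = some h).card := by
  by_contra! hlt
  refine hM.2 (Function.update M a (some h)) ⟨fun x g hx => ?_, fun g => ?_⟩ ?_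
  · by_cases hxa : x = a
    · subst hxa
      rw [Function.update_self] at hx
      cases hx
      exact hh
    · rw [Function.update_of_ne hxa] at hx
      exact hM.1.1 x g hx
  · by_cases hg : g = h
    · subst hg
      have : (Finset.univ.filter fun x => Function.update M a (some g) x = some g) ⊆
          insert a (Finset.univ.filter fun x => M x = some g) := by
        intro x hx
        by_cases hxa : x = a
        · simp [hxa]
        · simpa [hxa] using hx
      have := (Finset.card_le_card this).trans (Finset.card_insert_le _ _)
      omega
    · refine (Finset.card_le_card fun x hx => ?_).trans (hM.1.2 g)
      by_cases hxa : x = a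
      · subst hxa
        simp only [Finset.mem_filter, Function.update_self, Option.some.injEq] at hx
        exact absurd hx.2.symm hg
      · simpa [hxa] using hx
  · have hle : ∀ x ∈ Finset.univ, I.voteOf M (Function.update M a (some h)) x ≤
        if x = a then (-1 : ℤ) else 0 := by
      intro x _
      split_ifs with hxa
      · subst hxa
        exact (voteOf_of_prefers' (by simpa using hp)).le
      · exact (voteOf_of_eq (by simp [hxa])).le
    have := Finset.sum_le_sum hle
    simp only [Finset.sum_ite_eq', Finset.mem_univ, if_true] at this
    unfold vote
    omega

/-- In a popular matching, if some applicant prefers the house `h`, all applicants in `h` have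
`h` as their first choice. -/
theorem IsPopular.first_eq (hf : I.IsFirst f) {M : I.Assignment} (hM : I.IsPopular M)
    {a b : Fin I.n} {h : Fin I.m} (hh : h ∈ I.pref a) (hp : I.Prefers a (some h) (M a))
    (hb : M b = some h) : f b = h := by
  by_contra hne
  have hab : a ≠ b := by
    rintro rfl
    rw [hb] at hp
    exact lt_irrefl _ hp
  -- The deviation puts a into h in place of b, moves b to f(b), and evicts an occupant e of f(b):
  -- two applicants gain and at most one loses. The choice e = a means that nobody is evicted. It is
  -- made when no one except possibly a occupies f(b); as a leaves and capacities are positive, b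
  -- then fits.
  obtain ⟨e, he, heM⟩ : ∃ e, (e = a ∨ M e = some (f b) ∧ e ≠ a) ∧
      (e = a → ∀ x, x ≠ a → M x ≠ some (f b)) := by
    by_cases hex : ∃ e, M e = some (f b) ∧ e ≠ a
    · obtain ⟨e, he⟩ := hex
      exact ⟨e, Or.inr he, fun h => absurd h he.2⟩
    · push Not at hex
      exact ⟨a, Or.inl rfl, fun _ x hx hx' => hx (hex x hx')⟩
  have heb : e ≠ b := by
    rintro rfl
    rcases he with he | ⟨he, -⟩
    · exact hab he.symm
    · rw [hb] at he
      exact hne (Option.some.inj he).symm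
  let M' : I.Assignment := fun x =>
    if x = a then some h else if x = b then some (f b) else if x = e then none else M x
  refine hM.2 M' ⟨fun x g hx => ?_, fun g => ?_⟩ ?_
  · simp only [M'] at hx
    split_ifs at hx with h₁ h₂ h₃
    · cases hx; rw [h₁]; exact hh
    · cases hx; rw [h₂]; exact hf.mem b
    · exact hM.1.1 x g hx
  · by_cases hg : g = h
    · subst hg
      have hsub : (Finset.univ.filter fun x => M' x = some g) ⊆
          insert a ((Finset.univ.filter fun x => M x = some g).erase b) := by
        intro x hx
        simp only [M', Finset.mem_filter, Finset.mem_univ, true_and] at hx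
        split_ifs at hx with h₁ h₂ h₃
        · simp [h₁]
        · exact absurd (Option.some.inj hx) hne
        · simp [h₂, hx]
      have h₁ := (Finset.card_le_card hsub).trans (Finset.card_insert_le _ _)
      have hbm : b ∈ Finset.univ.filter fun x => M x = some g := by simp [hb]
      have h₂ := Finset.card_erase_of_mem hbm
      have h₃ := Finset.card_pos.2 ⟨b, hbm⟩
      have h₄ := hM.1.2 g
      omega
    · by_cases hg' : g = f b
      · subst hg'
        have hsub : (Finset.univ.filter fun x => M' x = some (f b)) ⊆
            insert b (((Finset.univ.filter fun x => M x = some (f b)).erase a).erase e) := by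
          intro x hx
          simp only [M', Finset.mem_filter, Finset.mem_univ, true_and] at hx
          split_ifs at hx with h₁ h₂ h₃
          · exact absurd (Option.some.inj hx).symm hg
          · simp [h₂]
          · simp [h₁, h₃, hx]
        have h₁ := (Finset.card_le_card hsub).trans (Finset.card_insert_le _ _)
        have h₄ := hM.1.2 (f b)
        have h₅ := I.cap_pos (f b)
        by_cases hea : e = a
        · have h₀ : ((Finset.univ.filter fun x => M x = some (f b)).erase a).erase e = ∅ := by
            refine Finset.eq_empty_of_forall_notMem fun x hx => ?_
            simp only [Finset.mem_erase, Finset.mem_filter, Finset.mem_univ, true_and] at hx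
            exact heM hea x hx.2.1 hx.2.2
          rw [h₀, Finset.card_empty] at h₁
          omega
        · obtain ⟨he', -⟩ := he.resolve_left hea
          have hem : e ∈ (Finset.univ.filter fun x => M x = some (f b)).erase a := by
            simp [hea, he']
          have h₂ := Finset.card_erase_of_mem hem
          have h₃ := Finset.card_pos.2 ⟨e, hem⟩
          have h₆ := Finset.card_erase_le (s := Finset.univ.filter fun x => M x = some (f b))
            (a := a)
          omega
      · refine (Finset.card_le_card fun x hx => ?_).trans (hM.1.2 g)
        simp only [M', Finset.mem_filter, Finset.mem_univ, true_and] at hx ⊢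
        split_ifs at hx with h₁ h₂ h₃
        · exact absurd (Option.some.inj hx).symm hg
        · exact absurd (Option.some.inj hx).symm hg'
        · exact hx
  · have hle : ∀ x ∈ Finset.univ, I.voteOf M M' x ≤
        (if x = a then (-1 : ℤ) else 0) + (if x = b then (-1 : ℤ) else 0) +
          (if x = e then (1 : ℤ) else 0) := by
      intro x _
      by_cases hxa : x = a
      · have : I.voteOf M M' x = -1 := by
          apply voteOf_of_prefers'
          simp only [M', hxa, if_true]
          exact hp
        rw [this, if_pos hxa, if_neg (by rw [hxa]; exact hab)]
        split_ifs <;> norm_num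
      · by_cases hxb : x = b
        · have : I.voteOf M M' x = -1 := by
            apply voteOf_of_prefers'
            simp only [M', hxb, if_neg hab.symm, if_true]
            apply hf.prefers
            rw [hb]
            exact fun h' => hne (Option.some.inj h').symm
          rw [this, if_neg hxa, if_pos hxb]
          split_ifs <;> norm_num
        · by_cases hxe : x = e
          · rw [if_neg hxa, if_neg hxb, if_pos hxe]
            simpa using voteOf_le_one M M' x
          · rw [if_neg hxa, if_neg hxb, if_neg hxe]
            exact (voteOf_of_eq (by simp [M', hxa, hxb, hxe])).le
    have := Finset.sum_le_sum hle
    simp only [Finset.sum_add_distrib, Finset.sum_ite_eq', Finset.mem_univ, if_true] at this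
    unfold vote
    omega

/-- In a popular matching, the first-choosers of a house with places for all of them are
assigned to it. -/
theorem IsPopular.eq_first (hf : I.IsFirst f) {M : I.Assignment} (hM : I.IsPopular M)
    {a : Fin I.n} (h : load f (f a) ≤ I.cap (f a)) : M a = some (f a) := by
  by_contra hne
  have hp := hf.prefers hne
  have h₁ := hM.cap_le (hf.mem a) hp
  -- If a is not in f(a), that house is full and holds only first-choosers other than a, which are
  -- fewer than its places.
  have hsub : (Finset.univ.filter fun x => M x = some (f a)) ⊆
      (Finset.univ.filter fun x => f x = f a).erase a := by
    intro x hx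
    simp only [Finset.mem_filter, Finset.mem_univ, true_and, Finset.mem_erase] at hx ⊢
    refine ⟨?_, hM.first_eq hf (hf.mem a) hp hx⟩
    rintro rfl
    exact hne hx
  have h₂ := Finset.card_le_card hsub
  rw [Finset.card_erase_of_mem (by simp)] at h₂
  have h₃ : 0 < (Finset.univ.filter fun x => f x = f a).card := Finset.card_pos.2 ⟨a, by simp⟩
  unfold load at h
  omega

/-- In a popular matching, a house that is not the first choice of one of its applicants has more
places than first-choosers. -/
theorem IsPopular.load_lt (hf : I.IsFirst f) {M : I.Assignment} (hM : I.IsPopular M)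
    {a : Fin I.n} {k : Fin I.m} (hk : M a = some k) (hne : f a ≠ k) : load f k < I.cap k := by
  -- A first-chooser of k placed elsewhere would prefer k and force a to be a first-chooser too.
  -- Hence k holds all its first-choosers and, in addition, a.
  have hsub : insert a (Finset.univ.filter fun x => f x = k) ⊆
      Finset.univ.filter fun x => M x = some k := by
    intro x hx
    simp only [Finset.mem_insert, Finset.mem_filter, Finset.mem_univ, true_and] at hx ⊢
    rcases hx with rfl | hx
    · exact hk
    · subst hx
      by_contra h'
      exact hne (hM.first_eq hf (hf.mem x) (hf.prefers h') hk)
  have h₁ := Finset.card_le_card hsub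
  rw [Finset.card_insert_of_notMem (by simp [hne])] at h₁
  have := hM.1.2 k
  unfold load
  omega

/-- In a popular matching, no applicant prefers a house with more places than first-choosers. -/
theorem IsPopular.not_prefers (hf : I.IsFirst f) {M : I.Assignment} (hM : I.IsPopular M)
    {a : Fin I.n} {h : Fin I.m} (hh : h ∈ I.pref a) (hl : load f h < I.cap h) :
    ¬ I.Prefers a (some h) (M a) := by
  intro hp
  have h₁ := hM.cap_le hh hp
  have hsub : (Finset.univ.filter fun x => M x = some h) ⊆
      Finset.univ.filter fun x => f x = h := by
    intro x hx
    simp only [Finset.mem_filter, Finset.mem_univ, true_and] at hx ⊢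
    exact hM.first_eq hf hh hp hx
  have := Finset.card_le_card hsub
  unfold load at hl
  omega

/-! ### First and second houses: a popular assignment for the increased capacities. -/

/-- `k` is the best house on the list of `a` with more places than first-choosers. -/
def IsSecond (I : HouseInstance) (f : Fin I.n → Fin I.m) (a : Fin I.n) (k : Fin I.m) : Prop :=
  k ∈ I.pref a ∧ load f k < I.cap k ∧
    ∀ h ∈ I.pref a, load f h < I.cap h → (I.pref a).idxOf k ≤ (I.pref a).idxOf h

/-- A sufficient condition for popularity. The houses in `T` are filled with first-choosers, and
every other applicant gets her best house outside `T`. -/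
theorem isPopular_of_full (hf : I.IsFirst f) {g : Fin I.n → Fin I.m} (T : Finset (Fin I.m))
    (hmem : ∀ a, g a ∈ I.pref a) (hcap : ∀ h, load g h ≤ I.cap h)
    (hfull : ∀ h ∈ T, I.cap h ≤ load g h) (hfirst : ∀ a, g a ∈ T → g a = f a)
    (hbest : ∀ a, g a ∉ T → ∀ h ∈ I.pref a, h ∉ T → h ≠ g a →
      (I.pref a).idxOf (g a) < (I.pref a).idxOf h) :
    I.IsPopular fun a => some (g a) := by
  classical
  refine ⟨⟨fun a h hh => ?_, fun h => ?_⟩, fun M' hM' => not_lt.2 ?_⟩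
  · cases hh
    exact hmem a
  · simpa [load] using hcap h
  -- A voter can turn against g only by moving into T from outside, and a voter of A who leaves T
  -- votes for g. So each vote is at least [a ∈ A] - [a ∈ B]. Since g fills T, the rival matching
  -- places no more applicants there, and the sum is nonnegative.
  · let A : Finset (Fin I.n) := Finset.univ.filter fun a => g a ∈ T
    let B : Finset (Fin I.n) := Finset.univ.filter fun a => ∃ h ∈ T, M' a = some h
    have hBA : B.card ≤ A.card := by
      have hA : A.card = ∑ h ∈ T, (A.filter fun a => g a = h).card :=
        Finset.card_eq_sum_card_fiberwise fun a ha => (Finset.mem_filter.1 ha).2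
      have hB : B ⊆ T.biUnion fun h => Finset.univ.filter fun a => M' a = some h := by
        intro a ha
        simpa [B] using ha
      refine (Finset.card_le_card hB).trans (Finset.card_biUnion_le.trans ?_)
      rw [hA]
      refine Finset.sum_le_sum fun h hh => ?_
      refine ((hM'.2 h).trans (hfull h hh)).trans (Finset.card_le_card fun a ha => ?_)
      have : g a = h := by simpa using ha
      simp [A, this, hh]
    have key : ∀ a ∈ Finset.univ, (if a ∈ A then (1 : ℤ) else 0) - (if a ∈ B then 1 else 0) ≤
        I.voteOf (fun a => some (g a)) M' a := by
      intro a _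
      by_cases heq : some (g a) = M' a
      · have : a ∈ A ↔ a ∈ B := by simp [A, B, ← heq]
        rw [voteOf_of_eq heq]
        simp [this]
      · by_cases hA : a ∈ A
        · have hT : g a ∈ T := by simpa [A] using hA
          rw [voteOf_of_prefers, if_pos hA]
          · split_ifs <;> norm_num
          · rw [hfirst a hT] at heq ⊢
            exact hf.prefers (Ne.symm heq)
        · by_cases hB : a ∈ B
          · rw [if_neg hA, if_pos hB]
            simpa using neg_one_le_voteOf (fun a => some (g a)) M' a
          · rw [voteOf_of_prefers, if_neg hA, if_neg hB]
            · norm_num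
            · cases hk : M' a with
              | none => trivial
              | some k =>
                rw [hk] at heq
                refine hbest a (by simpa [A] using hA) k (hM'.1 a k hk) (fun hT => hB ?_)
                  fun e => heq (by rw [e])
                simpa [B] using ⟨k, hT, hk⟩
    have hsum := Finset.sum_le_sum key
    simp only [Finset.sum_sub_distrib, Finset.sum_ite_mem, Finset.univ_inter, Finset.sum_const,
      nsmul_eq_mul, mul_one] at hsum
    refine le_trans ?_ hsum
    exact sub_nonneg.2 (by exact_mod_cast hBA)

/-- Popularity of an assignment to first and second houses when the capacities are increased as
little as possible. -/
theorem isPopular_increase (hf : I.IsFirst f) {g : Fin I.n → Fin I.m}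
    (hg : ∀ a, g a = f a ∨ I.IsSecond f a (g a))
    (hl : ∀ h, I.cap h ≤ load f h → I.cap h ≤ load g h) :
    (I.increase fun h => load g h - I.cap h).IsPopular fun a => some (g a) := by
  -- T is defined by the old capacities. The new capacity is the maximum of the old one and the load
  -- of g, so T is filled exactly; what the second houses are for the new capacities does not
  -- matter.
  let T : Finset (Fin I.m) := Finset.univ.filter fun h => I.cap h ≤ load f h
  have hT : ∀ h : Fin I.m, h ∈ T ↔ I.cap h ≤ load f h := by simp [T]
  refine isPopular_of_full (I := I.increase fun h => load g h - I.cap h) (f := f) hf T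
    (fun a => ?_) (fun h => ?_) (fun h hh => ?_)
    (fun a ha => ?_) fun a ha h hh hn hne => ?_
  · rcases hg a with h | h
    · rw [h]; exact hf.mem a
    · exact h.1
  · change load g h ≤ I.cap h + (load g h - I.cap h)
    omega
  · have := hl h ((hT h).1 hh)
    change I.cap h + (load g h - I.cap h) ≤ load g h
    omega
  · have h₁ : I.cap (g a) ≤ load f (g a) := (hT _).1 ha
    refine (hg a).resolve_right fun h => ?_
    exact absurd h.2.1 (not_lt.2 h₁)
  · have h₁ : load f h < I.cap h := by
      by_contra h'
      exact hn ((hT h).2 (Nat.le_of_not_lt h'))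
    rcases hg a with h₂ | h₂
    · rw [h₂] at hne ⊢
      exact hf.idxOf_lt hne
    · refine lt_of_le_of_ne (h₂.2.2 h hh h₁) fun e => hne ?_
      exact ((List.idxOf_inj h₂.1).1 e).symm

/-! ### Minimality of the increase. -/

/-- A lower bound for the total of a good capacity increase vector. -/
theorem sum_le_of_isGoodIncrease (hf : I.IsFirst f) {g : Fin I.n → Fin I.m}
    (Z : Finset (Fin I.m)) (hZf : ∀ a, g a ∈ Z → f a ∈ Z)
    (hZs : ∀ a, g a ∈ Z → I.cap (f a) < load f (f a) → ∀ k, I.IsSecond f a k → k ∈ Z)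
    (hZ : ∀ h, I.cap h < load g h → h ∈ Z) (hZl : ∀ h ∈ Z, I.cap h ≤ load g h)
    {r : Fin I.m → ℕ} (hr : I.IsGoodIncrease r) :
    ∑ h, (load g h - I.cap h) ≤ ∑ h, r h := by
  classical
  obtain ⟨M, hM, hp⟩ := hr
  choose p hp using hp
  obtain rfl : M = fun a => some (p a) := funext hp
  clear hp
  change Fin I.n → Fin I.m at p
  have hcap : ∀ h, load p h ≤ I.cap h + r h := fun h => by
    have e : (Finset.univ.filter fun a => p a = h) ⊆
        Finset.univ.filter fun a => some (p a) = some h := fun a ha => by simpa using ha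
    exact (Finset.card_le_card e).trans (hM.1.2 h)
  have hf' : (I.increase r).IsFirst f := hf
  -- These houses outside Z can become second houses only through the increase r.
  let N : Finset (Fin I.m) := Finset.univ.filter fun h =>
    (I.cap h ≤ load f h ∧ load f h < I.cap h + r h) ∧ h ∉ Z
  have hdisj : Disjoint Z N := by
    rw [Finset.disjoint_left]
    intro h h₁ h₂
    exact (Finset.mem_filter.1 h₂).2.2 h₁
  have hfp : ∀ a, load f (f a) ≤ I.cap (f a) + r (f a) → p a = f a := fun a ha => by
    exact Option.some.inj (hM.eq_first hf' (a := a) ha)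
  have hA : ∀ a, g a ∈ Z → p a ∈ Z ∪ N := by
    intro a ha
    by_cases hpa : p a = f a
    · rw [hpa]
      exact Finset.mem_union_left _ (hZf a ha)
    · have h₁ : I.cap (f a) < load f (f a) := by
        by_contra h'
        exact hpa (hfp a (by omega))
      have h₂ : load f (p a) < I.cap (p a) + r (p a) :=
        hM.load_lt hf' rfl (Ne.symm hpa)
      have hpm : p a ∈ I.pref a := hM.1.1 a _ rfl
      by_cases h₃ : p a ∈ Z
      · exact Finset.mem_union_left _ h₃
      · refine Finset.mem_union_right _ (Finset.mem_filter.2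
          ⟨Finset.mem_univ _, ⟨?_, h₂⟩, h₃⟩)
        -- Outside N, the house of a has more old places than first-choosers. Popularity rules out
        -- anything better of that kind, so it is her original second house, and Z contains it.
        by_contra h₄
        refine h₃ (hZs a ha h₁ _ ⟨hpm, by omega, fun h hh hl => ?_⟩)
        exact not_lt.1 (hM.not_prefers hf' (a := a) (h := h) hh
          (lt_of_lt_of_le hl (Nat.le_add_right _ _)))
  -- The two groups on the left are disjoint, because an applicant with g(a) in Z has her first
  -- house in Z and not in N.
  have hcount : ∑ h ∈ Z, load g h + ∑ h ∈ N, load f h ≤ ∑ h ∈ Z ∪ N, load p h := by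
    have e : ∀ (u : Fin I.n → Fin I.m) (S : Finset (Fin I.m)),
        ∑ h ∈ S, load u h = (Finset.univ.filter fun a => u a ∈ S).card := by
      intro u S
      have h := Finset.card_eq_sum_card_fiberwise (f := u) (t := S)
        (s := Finset.univ.filter fun a => u a ∈ S) fun a ha => by simpa using ha
      rw [h]
      refine Finset.sum_congr rfl fun h hh => ?_
      unfold load
      congr 1
      ext a
      simp only [Finset.mem_filter, Finset.mem_univ, true_and]
      constructor
      · rintro rfl; exact ⟨hh, rfl⟩
      · exact fun h => h.2
    rw [e, e, e, ← Finset.card_union_of_disjoint]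
    · refine Finset.card_le_card fun a ha => ?_
      simp only [Finset.mem_union, Finset.mem_filter, Finset.mem_univ, true_and] at ha
      simp only [Finset.mem_filter, Finset.mem_univ, true_and]
      rcases ha with ha | ha
      · exact hA a ha
      · rw [hfp a (Finset.mem_filter.1 ha).2.1.2.le]
        exact Finset.mem_union_right _ ha
    · rw [Finset.disjoint_left]
      intro a h₁ h₂
      simp only [Finset.mem_filter, Finset.mem_univ, true_and] at h₁ h₂
      exact Finset.disjoint_left.1 hdisj (hZf a h₁) h₂
  have h₁ : ∑ h ∈ Z, (load g h - I.cap h) + ∑ h ∈ Z, I.cap h = ∑ h ∈ Z, load g h := by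
    rw [← Finset.sum_add_distrib]
    refine Finset.sum_congr rfl fun h hh => ?_
    have := hZl h hh
    omega
  have h₂ : ∑ h ∈ Z, (load g h - I.cap h) = ∑ h, (load g h - I.cap h) := by
    refine Finset.sum_subset (Finset.subset_univ _) fun h _ hh => ?_
    by_contra h'
    exact hh (hZ h (by omega))
  have h₃ : ∑ h ∈ Z ∪ N, load p h ≤ ∑ h ∈ Z ∪ N, I.cap h + ∑ h ∈ Z ∪ N, r h := by
    rw [← Finset.sum_add_distrib]
    exact Finset.sum_le_sum fun h _ => hcap h
  have h₄ : ∑ h ∈ Z ∪ N, r h ≤ ∑ h, r h :=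
    Finset.sum_le_sum_of_subset (Finset.subset_univ _)
  have h₅ : ∑ h ∈ N, I.cap h ≤ ∑ h ∈ N, load f h :=
    Finset.sum_le_sum fun h hh => (Finset.mem_filter.1 hh).2.1.1
  rw [Finset.sum_union hdisj (f := I.cap)] at h₃
  omega

/-- If some applicant has no acceptable house, no capacity increase vector is good. -/
theorem not_isGoodIncrease {a : Fin I.n} (ha : I.pref a = []) (r : Fin I.m → ℕ) :
    ¬ I.IsGoodIncrease r := by
  rintro ⟨M, hM, hp⟩
  obtain ⟨h, hh⟩ := hp a
  have : h ∈ I.pref a := hM.1.1 a h hh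
  rw [ha] at this
  exact absurd this List.not_mem_nil

end HouseInstance

/-! ### Augmenting paths between overloaded and underloaded places. -/

namespace Rebalance

/-- The number of `a < n` with `g a = v`. -/
def cnt (n : ℕ) (g : ℕ → ℕ) (v : ℕ) : ℕ := ((Finset.range n).filter fun a => g a = v).card

theorem cnt_update {n a : ℕ} (g : ℕ → ℕ) (ha : a < n) (x u : ℕ) :
    cnt n (Function.update g a x) u + (if u = g a then 1 else 0) =
      cnt n g u + (if u = x then 1 else 0) := by
  have h : ∀ g' : ℕ → ℕ, cnt n g' u =
      (∑ b ∈ (Finset.range n).erase a, if g' b = u then 1 else 0) + if g' a = u then 1 else 0 := by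
    intro g'
    rw [cnt, Finset.card_filter, Finset.sum_erase_add _ _ (Finset.mem_range.2 ha)]
  rw [h, h g, Function.update_self]
  have hs : (∑ b ∈ (Finset.range n).erase a, if Function.update g a x b = u then 1 else 0) =
      ∑ b ∈ (Finset.range n).erase a, if g b = u then 1 else 0 :=
    Finset.sum_congr rfl fun b hb => by rw [Function.update_of_ne (Finset.ne_of_mem_erase hb)]
  rw [hs]
  simp only [eq_comm (a := u)]
  omega

/-- Item `a < n` is placed at `cur a` and can be moved to `alt a`; the two places are `F a` and
`S a`. The number of items at `v` is `load v`, and it is on the same side of `q v` as in the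
placement `F`. -/
structure Conf (n L : ℕ) (F S q cur alt load : ℕ → ℕ) : Prop where
  places : ∀ a, (cur a = F a ∧ alt a = S a) ∨ (cur a = S a ∧ alt a = F a)
  load_eq : ∀ v, load v = cnt n cur v
  ge : ∀ v, q v ≤ cnt n F v → q v ≤ load v
  le : ∀ v, cnt n F v ≤ q v → load v ≤ q v
  eq_of_le : ∀ a, n ≤ a → F a = S a
  lt : ∀ a < n, F a < L ∧ S a < L

variable {n L : ℕ} {F S q cur alt load R : ℕ → ℕ}

theorem Conf.eq (h : Conf n L F S q cur alt load) {a : ℕ} (ha : n ≤ a) : cur a = alt a := by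
  have := h.eq_of_le a ha
  rcases h.places a with h' | h' <;> omega

theorem Conf.lt_of_ne (h : Conf n L F S q cur alt load) {a : ℕ} (ha : cur a ≠ alt a) : a < n := by
  by_contra h'
  exact ha (h.eq (not_lt.1 h'))

theorem Conf.cur_lt (h : Conf n L F S q cur alt load) {a : ℕ} (ha : a < n) : cur a < L := by
  have := h.lt a ha
  rcases h.places a with h' | h' <;> omega

theorem Conf.alt_lt (h : Conf n L F S q cur alt load) {a : ℕ} (ha : a < n) : alt a < L := by
  have := h.lt a ha
  rcases h.places a with h' | h' <;> omega

theorem Conf.load_eq_zero (h : Conf n L F S q cur alt load) {v : ℕ} (hv : L ≤ v) : load v = 0 := by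
  rw [h.load_eq, cnt, Finset.card_eq_zero, Finset.filter_eq_empty_iff]
  intro a ha e
  have := h.cur_lt (Finset.mem_range.1 ha)
  omega

/-- The places marked by `R`. -/
def supp (L : ℕ) (R : ℕ → ℕ) : Finset ℕ := (Finset.range L).filter fun v => R v ≠ 0

/-- The marks are closed under moving items. -/
def Closed (cur alt R : ℕ → ℕ) : Prop := ∀ a, R (cur a) ≠ 0 → R (alt a) ≠ 0

/-- The marks `R` are those of a search from the overloaded places, which carry the mark `1`;
mark `a + 2` at `v` means that `v` was found along the arc from `cur a` to `alt a`. The places are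
found in the order of `rk`. -/
structure Search (L : ℕ) (q cur alt load R rk : ℕ → ℕ) : Prop where
  root : ∀ v, R v = 1 ↔ q v < load v
  arc : ∀ v, 2 ≤ R v → alt (R v - 2) = v ∧ R (cur (R v - 2)) ≠ 0 ∧ rk (cur (R v - 2)) < rk v
  rk_lt : ∀ v, R v ≠ 0 → rk v < (supp L R).card
  zero : ∀ v, L ≤ v → R v = 0

theorem Conf.search_init (h : Conf n L F S q cur alt load) (hR : ∀ v, L ≤ v → R v = 0)
    (hR' : ∀ v < L, R v = if load v - q v ≠ 0 then 1 else 0) :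
    Search L q cur alt load R fun _ => 0 := by
  have hlt : ∀ v, R v ≠ 0 → v < L := fun v hv => by
    by_contra h'
    exact hv (hR v (not_lt.1 h'))
  refine ⟨fun v => ?_, fun v hv => ?_, fun v hv => ?_, hR⟩
  · by_cases hv : v < L
    · by_cases hl : load v - q v ≠ 0
      · rw [hR' v hv, if_pos hl]
        exact ⟨fun _ => by omega, fun _ => rfl⟩
      · rw [hR' v hv, if_neg hl]
        exact ⟨fun e => absurd e (by norm_num), fun _ => by omega⟩
    · have := h.load_eq_zero (not_lt.1 hv)
      have := hR v (not_lt.1 hv)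
      omega
  · have h₁ := hR' v (hlt v (by intro e; rw [e] at hv; omega))
    split_ifs at h₁ <;> omega
  · exact Finset.card_pos.2 ⟨v, by simp [supp, hlt v hv, hv]⟩

theorem Search.step {rk : ℕ → ℕ} (hs : Search L q cur alt load R rk)
    (h : Conf n L F S q cur alt load) {a : ℕ} (hc : R (cur a) ≠ 0) (ha : R (alt a) = 0) :
    (∃ rk', Search L q cur alt load (Function.update R (alt a) (a + 2)) rk') ∧
      (supp L (Function.update R (alt a) (a + 2))).card = (supp L R).card + 1 := by
  have hne : cur a ≠ alt a := fun e => hc (e ▸ ha)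
  have han := h.lt_of_ne hne
  have hcard : (supp L (Function.update R (alt a) (a + 2))).card = (supp L R).card + 1 := by
    have : supp L (Function.update R (alt a) (a + 2)) = insert (alt a) (supp L R) := by
      ext u
      by_cases hu : u = alt a
      · subst hu; simp [supp, h.alt_lt han]
      · simp [supp, hu]
    rw [this, Finset.card_insert_of_notMem (by simp [supp, ha])]
  -- The new place is ranked by the number of earlier marks, which exceeds all their ranks; ranks
  -- therefore decrease towards the roots.
  refine ⟨⟨Function.update rk (alt a) (supp L R).card, fun v => ?_, fun v hv => ?_, fun v hv => ?_,
    fun v hv => ?_⟩, hcard⟩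
  · by_cases hv : v = alt a
    · subst hv
      have := hs.root (alt a)
      rw [Function.update_self]
      omega
    · rw [Function.update_of_ne hv]
      exact hs.root v
  · by_cases hva : v = alt a
    · subst hva
      simp only [Function.update_self, Nat.add_sub_cancel]
      rw [Function.update_of_ne hne, Function.update_of_ne hne]
      exact ⟨trivial, hc, hs.rk_lt _ hc⟩
    · rw [Function.update_of_ne hva] at hv ⊢
      obtain ⟨h₁, h₂, h₃⟩ := hs.arc v hv
      have h₄ : cur (R v - 2) ≠ alt a := fun e => h₂ (e ▸ ha)
      rw [Function.update_of_ne h₄, Function.update_of_ne h₄, Function.update_of_ne hva]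
      exact ⟨h₁, h₂, h₃⟩
  · rw [hcard]
    by_cases hva : v = alt a
    · subst hva
      rw [Function.update_self]
      omega
    · rw [Function.update_of_ne hva] at hv ⊢
      have := hs.rk_lt v hv
      omega
  · have := h.alt_lt han
    rw [Function.update_of_ne (by omega)]
    exact hs.zero v hv

theorem Conf.closed_of_card (h : Conf n L F S q cur alt load) (hR : L ≤ (supp L R).card) :
    Closed cur alt R := by
  have hs : supp L R = Finset.range L :=
    Finset.eq_of_subset_of_card_le (Finset.filter_subset _ _) (by simpa using hR)
  intro a ha
  by_cases han : a < n
  · have : alt a ∈ supp L R := by rw [hs]; exact Finset.mem_range.2 (h.alt_lt han)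
    exact (Finset.mem_filter.1 this).2
  · rwa [← h.eq (not_lt.1 han)]

theorem Search.card_le {rk : ℕ → ℕ} (_ : Search L q cur alt load R rk) :
    (supp L R).card ≤ L :=
  (Finset.card_filter_le _ _).trans (by simp)

/-- While a path found by a search is reversed from its end `t`, one item is in transit
at `v`. -/
structure Trace (n : ℕ) (F S load R rk cur₀ : ℕ → ℕ) (t : ℕ) (cur alt : ℕ → ℕ) (v : ℕ) :
    Prop where
  mark : R v ≠ 0
  places : ∀ a, (cur a = F a ∧ alt a = S a) ∨ (cur a = S a ∧ alt a = F a)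
  count : ∀ u, cnt n cur u + (if u = v then 1 else 0) = load u + (if u = t then 1 else 0)
  keep : ∀ u, 2 ≤ R u → rk u ≤ rk v → alt (R u - 2) = u ∧ cur (R u - 2) = cur₀ (R u - 2)

theorem Search.trace_init {rk : ℕ → ℕ} (hs : Search L q cur alt load R rk)
    (h : Conf n L F S q cur alt load) {t : ℕ} (ht : R t ≠ 0) :
    Trace n F S load R rk cur t cur alt t :=
  ⟨ht, h.places, fun u => by rw [h.load_eq], fun u hu _ => ⟨(hs.arc u hu).1, rfl⟩⟩

/-- Relative to the intended loads, v is short of one item. The item named by the mark of v fills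
the gap and opens one at its previous place, which has smaller rank. Only arcs of rank at most that
of v need to be intact, and these have not yet been reversed. -/
theorem Trace.step {rk cur' alt' : ℕ → ℕ} {t v : ℕ} (hs : Search L q cur alt load R rk)
    (h : Conf n L F S q cur alt load) (ht : Trace n F S load R rk cur t cur' alt' v)
    (hv : 2 ≤ R v) :
    Trace n F S load R rk cur t (Function.update cur' (R v - 2) v)
        (Function.update alt' (R v - 2) (cur' (R v - 2))) (cur' (R v - 2)) ∧
      rk (cur' (R v - 2)) < rk v := by
  obtain ⟨h₁, h₂, h₃⟩ := hs.arc v hv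
  obtain ⟨h₄, h₅⟩ := ht.keep v hv le_rfl
  rw [h₅]
  generalize ha : R v - 2 = a at *
  have hne : cur a ≠ alt a := by
    intro e
    rw [e, h₁] at h₃
    exact lt_irrefl _ h₃
  refine ⟨⟨h₂, fun b => ?_, fun u => ?_, fun u hu hru => ?_⟩, h₃⟩
  · by_cases hb : b = a
    · subst hb
      rw [Function.update_self, Function.update_self]
      have := ht.places b
      rw [h₄, h₅] at this
      tauto
    · rw [Function.update_of_ne hb, Function.update_of_ne hb]
      exact ht.places b
  · have e₁ := cnt_update cur' (h.lt_of_ne hne) v u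
    have e₂ := ht.count u
    rw [h₅] at e₁
    omega
  -- An item determines the place found along its arc, so a lower-ranked place was found along
  -- another item.
  · have hne' : R u - 2 ≠ a := by
      intro e
      have h₆ := (hs.arc u hu).1
      rw [e, h₁] at h₆
      rw [h₆] at h₃
      omega
    rw [Function.update_of_ne hne', Function.update_of_ne hne']
    exact ht.keep u hu (by omega)

/-- The total overload. -/
def excess (L : ℕ) (q load : ℕ → ℕ) : ℕ := ∑ v ∈ Finset.range L, (load v - q v)

/-- Loads change only at the ends of the path. The underloaded end gains one item and does not
exceed its capacity; the overloaded root loses one and does not fall below. So no place changes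
sides, and the excess drops by exactly one. -/
theorem Trace.finish {rk cur' alt' : ℕ → ℕ} {t v : ℕ} (hs : Search L q cur alt load R rk)
    (h : Conf n L F S q cur alt load) (ht : Trace n F S load R rk cur t cur' alt' v)
    (hv : R v = 1) (htq : load t < q t) {load' : ℕ → ℕ}
    (hl : load' = Function.update (Function.update load t (load t + 1)) v
      (Function.update load t (load t + 1) v - 1)) :
    Conf n L F S q cur' alt' load' ∧ excess L q load' + 1 = excess L q load := by
  have hvq := (hs.root v).1 hv
  have hne : v ≠ t := by rintro rfl; omega
  have hload : ∀ u, load' u + (if u = v then 1 else 0) = load u + (if u = t then 1 else 0) := by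
    intro u
    rw [hl]
    by_cases huv : u = v
    · subst huv
      rw [Function.update_self, Function.update_of_ne hne, if_pos rfl, if_neg hne]
      omega
    · rw [Function.update_of_ne huv, if_neg huv]
      by_cases hut : u = t
      · subst hut; simp
      · simp [hut]
  refine ⟨⟨ht.places, fun u => ?_, fun u hu => ?_, fun u hu => ?_, h.eq_of_le, h.lt⟩, ?_⟩
  · have := hload u
    have := ht.count u
    omega
  · have h₁ := hload u
    have h₂ := h.ge u hu
    by_cases huv : u = v
    · subst huv; rw [if_pos rfl, if_neg hne] at h₁; omega
    · rw [if_neg huv] at h₁; omega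
  · have h₁ := hload u
    have h₂ := h.le u hu
    by_cases hut : u = t
    · subst hut; rw [if_pos rfl, if_neg (Ne.symm hne)] at h₁; omega
    · rw [if_neg hut] at h₁; omega
  · have hvL : v < L := by
      by_contra h'
      have := hs.zero v (not_lt.1 h')
      omega
    unfold excess
    have hmem : v ∈ Finset.range L := Finset.mem_range.2 hvL
    rw [← Finset.sum_erase_add _ _ hmem, ← Finset.sum_erase_add _ _ hmem]
    have : ∑ u ∈ (Finset.range L).erase v, (load' u - q u) =
        ∑ u ∈ (Finset.range L).erase v, (load u - q u) := by
      refine Finset.sum_congr rfl fun u hu => ?_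
      have h₁ := hload u
      rw [if_neg (Finset.ne_of_mem_erase hu)] at h₁
      by_cases hut : u = t
      · subst hut; rw [if_pos rfl] at h₁; omega
      · rw [if_neg hut] at h₁; omega
    have h₁ := hload v
    rw [if_pos rfl, if_neg hne] at h₁
    omega

/-- No item can be moved out of a set of places that contains the overloaded ones and no
underloaded one. -/
def Optimal (q cur alt load : ℕ → ℕ) : Prop :=
  ∃ Z : Set ℕ, (∀ a, cur a ∈ Z → alt a ∈ Z) ∧ (∀ v, q v < load v → v ∈ Z) ∧
    ∀ v ∈ Z, q v ≤ load v

theorem Conf.excess_le (h : Conf n L F S q cur alt load) : excess L q load ≤ n := by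
  calc excess L q load ≤ ∑ v ∈ Finset.range L, cnt n cur v :=
        Finset.sum_le_sum fun v _ => by rw [h.load_eq]; exact Nat.sub_le _ _
    _ = (Finset.range n).card :=
        (Finset.card_eq_sum_card_fiberwise fun a ha => by
          simpa using h.cur_lt (by simpa using ha)).symm
    _ = n := Finset.card_range n

theorem Conf.optimal_of_excess (h : Conf n L F S q cur alt load) (h0 : excess L q load = 0) :
    Optimal q cur alt load := by
  refine ⟨∅, by simp, fun v hv => ?_, by simp⟩
  have hvL : v < L := by
    by_contra h'
    have := h.load_eq_zero (not_lt.1 h')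
    omega
  have := Finset.sum_eq_zero_iff.1 h0 v (Finset.mem_range.2 hvL)
  omega

theorem Search.optimal {rk : ℕ → ℕ} (hs : Search L q cur alt load R rk)
    (hc : Closed cur alt R) (hn : ∀ v, R v ≠ 0 → q v ≤ load v) : Optimal q cur alt load :=
  ⟨{v | R v ≠ 0}, hc, fun v hv => by
    have := (hs.root v).2 hv
    simp [this], hn⟩

end Rebalance

/-! ### The program: reading the instance. -/

namespace HouseProgram

open RAM Rebalance

/-! The program works on the following arrays: `6` capacities, `7` positions of the preference lists
in the input, `8` and `10` current and alternative house of each applicant, `11` loads of the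
houses, `12` marks of the search, `13` one plus the house found by the search, or zero, `14`, `15` and `9`
house, applicant and previous house while a path is reversed, `16` whether some list is empty.
The first cells of the arrays `3`, `4` and `5` are loop counters. The instance starts at position `off` of the input. -/

/-- The first cell of array `a`. -/
def var (a : ℕ) : Expr := .get a (.const 0)

@[simp] theorem eval_var (s : Memory) (a : ℕ) : (var a).eval s = s a 0 := by
  rw [var, Expr.eval, Expr.eval]

@[simp] theorem eval_const (s : Memory) (n : ℕ) : (Expr.const n).eval s = n := by
  rw [Expr.eval]

@[simp] theorem eval_get (s : Memory) (a : ℕ) (e : Expr) :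
    (Expr.get a e).eval s = s a (e.eval s) := by
  rw [Expr.eval]

@[simp] theorem eval_add (s : Memory) (e e' : Expr) :
    (Expr.add e e').eval s = e.eval s + e'.eval s := by
  rw [Expr.eval]

@[simp] theorem eval_sub (s : Memory) (e e' : Expr) :
    (Expr.sub e e').eval s = e.eval s - e'.eval s := by
  rw [Expr.eval]

/-- Read the capacities. -/
def readCaps (off : ℕ) : Code :=
  .rep 3 (.cond (.sub (.get 0 (.const (off + 1))) (var 3))
    (.assign 6 (var 3) (.get 0 (.add (.const (off + 2)) (var 3)))) .skip)

/-- Every loop runs n + m times, so bodies meant for fewer indices are guarded by a truncated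
difference that vanishes out of range. This causes the double bounds in the invariants here and
below. -/
theorem den_readCaps (off : ℕ) (s : Memory) (h6 : s 6 = 0) (hL : s 0 (off + 1) ≤ s 2 0) (v : ℕ) :
    (readCaps off).den s 6 v = if v < s 0 (off + 1) then s 0 (off + 2 + v) else 0 := by
  have := Code.den_rep_induction (v := 3) s (p := (.cond (.sub (.get 0 (.const (off + 1))) (var 3))
    (.assign 6 (var 3) (.get 0 (.add (.const (off + 2)) (var 3)))) .skip))
    (fun i s' => ∀ v, s' 6 v = if v < i ∧ v < s 0 (off + 1) then s 0 (off + 2 + v) else 0)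
    (by simp [Memory.set_ne, h6]) ?_
  · rw [readCaps, this v]
    exact if_congr (by omega) rfl rfl
  · intro i hi s' hk h3 ih v
    have h0 : s' 0 = s 0 := hk 0 rfl
    rw [Memory.set_ne _ _ _ (by norm_num)]
    simp only [Code.den, eval_sub, eval_get, eval_const, eval_var, eval_add, h0, h3]
    by_cases h₁ : s 0 (off + 1) - i = 0
    · rw [if_pos h₁, ih]
      exact if_congr (by omega) rfl rfl
    · rw [if_neg h₁, Memory.set_same]
      by_cases hv : v = i
      · subst hv
        rw [Function.update_self, if_pos (by omega)]
      · rw [Function.update_of_ne hv, ih]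
        exact if_congr (by omega) rfl rfl

/-- The position of the preference list of each applicant, given the position of the first. -/
def posn (w : ℕ → ℕ) (p : ℕ) : ℕ → ℕ
  | 0 => p
  | a + 1 => posn w p a + w (posn w p a) + 1

/-- Compute the positions of the preference lists. -/
def readPos (off : ℕ) : Code :=
  .seq (.assign 7 (.const 0) (.add (.const (off + 2)) (.get 0 (.const (off + 1)))))
    (.rep 3 (.cond (.sub (.get 0 (.const off)) (var 3))
      (.assign 7 (.add (var 3) (.const 1))
        (.add (.add (.get 7 (var 3)) (.get 0 (.get 7 (var 3)))) (.const 1))) .skip))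

theorem den_readPos (off : ℕ) (s : Memory) (hL : s 0 off ≤ s 2 0) (a : ℕ) (ha : a ≤ s 0 off) :
    (readPos off).den s 7 a = posn (s 0) (off + 2 + s 0 (off + 1)) a := by
  rw [readPos, Code.den, Code.den]
  set s₀ := s.set 7 ((Expr.const 0).eval s)
    ((Expr.add (.const (off + 2)) (.get 0 (.const (off + 1)))).eval s) with hs₀
  have h2 : s₀ 2 = s 2 := Memory.set_ne _ _ _ (by norm_num)
  have h0 : s₀ 0 = s 0 := Memory.set_ne _ _ _ (by norm_num)
  have := Code.den_rep_induction (v := 3) s₀ (p := (.cond (.sub (.get 0 (.const off)) (var 3))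
      (.assign 7 (.add (var 3) (.const 1))
        (.add (.add (.get 7 (var 3)) (.get 0 (.get 7 (var 3)))) (.const 1))) .skip))
    (fun i s' => ∀ a ≤ i, a ≤ s 0 off → s' 7 a = posn (s 0) (off + 2 + s 0 (off + 1)) a)
    ?_ ?_
  · exact this a (by rw [h2]; omega) ha
  · intro a ha _
    obtain rfl : a = 0 := by omega
    simp [hs₀, Memory.set_ne, posn]
  · intro i hi s' hk h3 ih a hai han
    have h0' : s' 0 = s 0 := (hk 0 rfl).trans h0
    rw [Memory.set_ne _ _ _ (by norm_num)]
    simp only [Code.den, eval_sub, eval_get, eval_const, eval_var, eval_add, h0', h3]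
    split_ifs with h₁
    · exact ih a (by omega) han
    · rw [Memory.set_same]
      by_cases hv : a = i + 1
      · subst hv
        rw [Function.update_self, ih i le_rfl (by omega), posn]
      · rw [Function.update_of_ne hv]
        exact ih a (by omega) han

/-- Record whether some preference list is empty. -/
def readEmpty (off : ℕ) : Code :=
  .rep 3 (.cond (.sub (.get 0 (.const off)) (var 3))
    (.cond (.get 0 (.get 7 (var 3))) .skip (.assign 16 (.const 0) (.const 1))) .skip)

theorem den_readEmpty (off : ℕ) (s : Memory) (h16 : s 16 = 0) (hL : s 0 off ≤ s 2 0) :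
    (readEmpty off).den s 16 0 ≠ 0 ↔ ∃ a < s 0 off, s 0 (s 7 a) = 0 := by
  have := Code.den_rep_induction (v := 3) s (p := (.cond (.sub (.get 0 (.const off)) (var 3))
    (.cond (.get 0 (.get 7 (var 3))) .skip (.assign 16 (.const 0) (.const 1))) .skip))
    (fun i s' => s' 16 0 ≠ 0 ↔ ∃ a < s 0 off, a < i ∧ s 0 (s 7 a) = 0)
    (by simp [Memory.set_ne, h16]) ?_
  · rw [readEmpty, this]
    exact ⟨fun ⟨a, h₁, h₂⟩ => ⟨a, h₁, h₂.2⟩, fun ⟨a, h₁, h₂⟩ => ⟨a, h₁, by omega, h₂⟩⟩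
  · intro i hi s' hk h3 ih
    have h0 : s' 0 = s 0 := hk 0 rfl
    have h7 : s' 7 = s 7 := hk 7 rfl
    rw [Memory.set_ne _ _ _ (by norm_num)]
    simp only [Code.den, eval_sub, eval_get, eval_const, eval_var, h0, h3, h7]
    split_ifs with h₁ h₂
    · rw [ih]
      exact ⟨fun ⟨a, h₃, h₄⟩ => ⟨a, h₃, by omega, h₄.2⟩,
        fun ⟨a, h₃, h₄, h₅⟩ => ⟨a, h₃, by omega, h₅⟩⟩
    · simp only [Memory.set_same, Function.update_self]
      exact ⟨fun _ => ⟨i, by omega, by omega, by omega⟩, fun _ => by norm_num⟩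
    · rw [ih]
      refine ⟨fun ⟨a, h₃, h₄⟩ => ⟨a, h₃, by omega, h₄.2⟩, fun ⟨a, h₃, h₄, h₅⟩ => ⟨a, h₃, ?_, h₅⟩⟩
      rcases Nat.lt_succ_iff_lt_or_eq.1 h₄ with h | rfl
      · exact h
      · exact absurd h₅ h₂

/-- Assign all applicants to their first houses. -/
def readFirst (off : ℕ) : Code :=
  .rep 3 (.cond (.sub (.get 0 (.const off)) (var 3))
    (.seq (.assign 8 (var 3) (.get 0 (.add (.get 7 (var 3)) (.const 1))))
      (.seq (.assign 10 (var 3) (.get 8 (var 3)))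
        (.assign 11 (.get 8 (var 3)) (.add (.get 11 (.get 8 (var 3))) (.const 1))))) .skip)

theorem cnt_succ (n : ℕ) (g : ℕ → ℕ) (v : ℕ) :
    cnt (n + 1) g v = cnt n g v + if v = g n then 1 else 0 := by
  rw [cnt, cnt, Finset.range_add_one, Finset.filter_insert]
  by_cases h : g n = v
  · rw [if_pos h, if_pos h.symm, Finset.card_insert_of_notMem (by simp)]
  · rw [if_neg h, if_neg (Ne.symm h), Nat.add_zero]

theorem cnt_congr {n : ℕ} {g g' : ℕ → ℕ} (h : ∀ a < n, g a = g' a) (v : ℕ) :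
    cnt n g v = cnt n g' v := by
  unfold cnt
  congr 1
  refine Finset.filter_congr fun a ha => ?_
  rw [h a (Finset.mem_range.1 ha)]

theorem den_readFirst (off : ℕ) (s : Memory) (h8 : s 8 = 0) (h10 : s 10 = 0) (h11 : s 11 = 0)
    (hL : s 0 off ≤ s 2 0) :
    (∀ a, (readFirst off).den s 8 a = if a < s 0 off then s 0 (s 7 a + 1) else 0) ∧
    (readFirst off).den s 10 = (readFirst off).den s 8 ∧
    ∀ v, (readFirst off).den s 11 v = cnt (s 0 off) ((readFirst off).den s 8) v := by
  have := Code.den_rep_induction (v := 3) s (p := (.cond (.sub (.get 0 (.const off)) (var 3))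
    (.seq (.assign 8 (var 3) (.get 0 (.add (.get 7 (var 3)) (.const 1))))
      (.seq (.assign 10 (var 3) (.get 8 (var 3)))
        (.assign 11 (.get 8 (var 3)) (.add (.get 11 (.get 8 (var 3))) (.const 1))))) .skip))
    (fun i s' => (∀ a, s' 8 a = if a < i ∧ a < s 0 off then s 0 (s 7 a + 1) else 0) ∧
      s' 10 = s' 8 ∧ ∀ v, s' 11 v = cnt (min i (s 0 off)) (s' 8) v)
    (by simp [Memory.set_ne, h8, h10, h11, cnt]) ?_
  · obtain ⟨h₁, h₂, h₃⟩ := this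
    refine ⟨fun a => ?_, h₂, fun v => ?_⟩
    · rw [readFirst, h₁]
      exact if_congr (by omega) rfl rfl
    · rw [readFirst, h₃, min_eq_right hL]
  · rintro i hi s' hk h3 ⟨ih₁, ih₂, ih₃⟩
    have h0 : s' 0 = s 0 := hk 0 rfl
    have h7 : s' 7 = s 7 := hk 7 rfl
    simp only [Memory.set_ne, ne_eq, Nat.reduceEqDiff, not_false_eq_true,
      Code.den, eval_sub, eval_get, eval_const, eval_var, h0, h3]
    split_ifs with h₁
    · refine ⟨fun a => ?_, ih₂, fun v => ?_⟩
      · rw [ih₁]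
        exact if_congr (by omega) rfl rfl
      · rw [ih₃, show min (i + 1) (s 0 off) = min i (s 0 off) by omega]
    · simp only [Memory.set_ne, Memory.set_same, ne_eq, Nat.reduceEqDiff, not_false_eq_true,
        eval_get, eval_add, eval_const, eval_var, h3, h7, Function.update_self, ih₂]
      refine ⟨fun a => ?_, trivial, fun v => ?_⟩
      · by_cases ha : a = i
        · subst ha
          rw [Function.update_self, if_pos (by omega)]
        · rw [Function.update_of_ne ha, ih₁]
          exact if_congr (by omega) rfl rfl
      · rw [show min (i + 1) (s 0 off) = i + 1 by omega, cnt_succ, Function.update_self,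
          cnt_congr (g' := s' 8) fun a ha => Function.update_of_ne (by omega) _ _]
        have := ih₃ v
        rw [show min i (s 0 off) = i by omega] at this
        by_cases hv : v = s 0 (s 7 i + 1)
        · subst hv
          rw [Function.update_self, if_pos rfl, this]
        · rw [Function.update_of_ne hv, if_neg hv, this, Nat.add_zero]

/-- Search the preference list of applicant `i`, from its end, for a house with more places than
first-choosers. -/
def secondOf : Code :=
  .rep 4 (.cond (.sub (.get 0 (.get 7 (var 3))) (var 4))
    (.seq (.assign 15 (.const 0)
        (.get 0 (.add (.get 7 (var 3)) (.sub (.get 0 (.get 7 (var 3))) (var 4)))))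
      (.cond (.sub (.get 6 (var 15)) (.get 11 (var 15))) (.assign 10 (var 3) (var 15)) .skip))
    .skip)

/-- `x` is the first element `u 0, ..., u (k - 1)` with property `P`, and `y` if there
is none. -/
def FirstWith (P : ℕ → Prop) (u : ℕ → ℕ) (k y x : ℕ) : Prop :=
  ((∀ j < k, ¬ P (u j)) ∧ x = y) ∨ ∃ j < k, x = u j ∧ P (u j) ∧ ∀ j' < j, ¬ P (u j')

/-- The list is scanned from its end and each hit overwrites the previous one, so the most preferred
hit survives without an early exit from the loop. -/
theorem FirstWith.cons {P : ℕ → Prop} {u : ℕ → ℕ} {k y x : ℕ}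
    (h : FirstWith P (fun j => u (j + 1)) k y x) [Decidable (P (u 0))] :
    FirstWith P u (k + 1) y (if P (u 0) then u 0 else x) := by
  split_ifs with h0
  · exact Or.inr ⟨0, by omega, rfl, h0, by omega⟩
  · rcases h with ⟨h, rfl⟩ | ⟨j, hj, rfl, h₁, h₂⟩
    · refine Or.inl ⟨fun j hj => ?_, rfl⟩
      cases j with
      | zero => exact h0
      | succ j => exact h j (by omega)
    · refine Or.inr ⟨j + 1, by omega, rfl, h₁, fun j' hj' => ?_⟩
      cases j' with
      | zero => exact h0
      | succ j' => exact h₂ j' (by omega)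

theorem den_secondOf (s : Memory) (hL : s 0 (s 7 (s 3 0)) ≤ s 2 0) :
    (∀ a ≠ s 3 0, secondOf.den s 10 a = s 10 a) ∧
    FirstWith (fun h => s 11 h < s 6 h) (fun j => s 0 (s 7 (s 3 0) + 1 + j))
      (s 0 (s 7 (s 3 0))) (s 10 (s 3 0)) (secondOf.den s 10 (s 3 0)) := by
  set p := s 7 (s 3 0) with hp
  set k := s 0 p with hk'
  have := Code.den_rep_induction (v := 4) s
    (p := (.cond (.sub (.get 0 (.get 7 (var 3))) (var 4))
    (.seq (.assign 15 (.const 0)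
        (.get 0 (.add (.get 7 (var 3)) (.sub (.get 0 (.get 7 (var 3))) (var 4)))))
      (.cond (.sub (.get 6 (var 15)) (.get 11 (var 15))) (.assign 10 (var 3) (var 15)) .skip))
    .skip))
    -- After i rounds the last min(i, k) entries have been seen; this suffix starts at offset k -
    -- min(i, k).
    (fun i s' => (∀ a ≠ s 3 0, s' 10 a = s 10 a) ∧
      FirstWith (fun h => s 11 h < s 6 h) (fun j => s 0 (p + 1 + (k - min i k) + j))
        (min i k) (s 10 (s 3 0)) (s' 10 (s 3 0)))
    ?_ ?_
  · obtain ⟨h₁, h₂⟩ := this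
    rw [min_eq_right hL] at h₂
    simp only [Nat.sub_self, Nat.add_zero] at h₂
    exact ⟨h₁, h₂⟩
  · simp [Memory.set_ne, FirstWith]
  · rintro i hi s' hk h4 ⟨ih₁, ih₂⟩
    have h0 : s' 0 = s 0 := hk 0 rfl
    have h7 : s' 7 = s 7 := hk 7 rfl
    have h3 : s' 3 = s 3 := hk 3 rfl
    have h6 : s' 6 = s 6 := hk 6 rfl
    have h11 : s' 11 = s 11 := hk 11 rfl
    by_cases hik : k - i = 0
    · simp only [Memory.set_ne, ne_eq, Nat.reduceEqDiff, not_false_eq_true, Code.den, eval_sub,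
        eval_get, eval_var, h0, h3, h4, h7, ← hp, ← hk', hik, if_true]
      rw [show min (i + 1) k = min i k by omega]
      exact ⟨ih₁, ih₂⟩
    · have hu : (fun j => s 0 (p + 1 + (k - min i k) + j)) =
          fun j => s 0 (p + 1 + (k - min (i + 1) k) + (j + 1)) :=
        funext fun j => congrArg _ (by omega)
      rw [hu, show min i k = i by omega] at ih₂
      have ih₃ := ih₂.cons (u := fun j => s 0 (p + 1 + (k - min (i + 1) k) + j))
      have hidx : p + 1 + (k - min (i + 1) k) + 0 = p + (k - i) := by omega
      simp only [hidx] at ih₃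
      rw [show min (i + 1) k = i + 1 by omega] at ih₃ ⊢
      simp only [Memory.set_ne, Memory.set_same, ne_eq, Nat.reduceEqDiff, not_false_eq_true,
        Code.den, eval_sub, eval_get, eval_add, eval_const, eval_var, h0, h3, h4, h7, h6, h11,
        ← hp, ← hk', hik, if_false, Function.update_self]
      by_cases hc : s 6 (s 0 (p + (k - i))) - s 11 (s 0 (p + (k - i))) = 0
      · rw [if_pos hc, Memory.set_ne _ _ _ (by norm_num)]
        rw [if_neg (by omega)] at ih₃
        exact ⟨ih₁, ih₃⟩
      · rw [if_neg hc, Memory.set_same, Memory.set_ne _ _ _ (by norm_num)]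
        rw [if_pos (by omega)] at ih₃
        refine ⟨fun a ha => ?_, ?_⟩
        · rw [Function.update_of_ne ha]
          exact ih₁ a ha
        · rw [Function.update_self]
          exact ih₃

/-- Find the alternative houses of the applicants whose first houses are overloaded. -/
def readSecond (off : ℕ) : Code :=
  .rep 3 (.cond (.sub (.get 0 (.const off)) (var 3))
    (.cond (.sub (.get 11 (.get 8 (var 3))) (.get 6 (.get 8 (var 3)))) secondOf .skip) .skip)

/-- Only applicants with an overloaded first house may move. All others, and those without a second
house, keep their old entry in array `10`; when it equals the one in array `8`, they provide no arc.
-/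
theorem den_readSecond (off : ℕ) (s : Memory)
    (hk : ∀ a < s 0 off, s 0 (s 7 a) ≤ s 2 0) (hL : s 0 off ≤ s 2 0) :
    (∀ a, s 0 off ≤ a ∨ s 11 (s 8 a) ≤ s 6 (s 8 a) → (readSecond off).den s 10 a = s 10 a) ∧
    ∀ a < s 0 off, s 6 (s 8 a) < s 11 (s 8 a) →
      FirstWith (fun h => s 11 h < s 6 h) (fun j => s 0 (s 7 a + 1 + j))
        (s 0 (s 7 a)) (s 10 a) ((readSecond off).den s 10 a) := by
  have := Code.den_rep_induction (v := 3) s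
    (p := (.cond (.sub (.get 0 (.const off)) (var 3))
    (.cond (.sub (.get 11 (.get 8 (var 3))) (.get 6 (.get 8 (var 3)))) secondOf .skip) .skip))
    (fun i s' => (∀ a, (i ≤ a ∨ s 0 off ≤ a) ∨ s 11 (s 8 a) ≤ s 6 (s 8 a) → s' 10 a = s 10 a) ∧
      ∀ a < s 0 off, a < i → s 6 (s 8 a) < s 11 (s 8 a) →
        FirstWith (fun h => s 11 h < s 6 h) (fun j => s 0 (s 7 a + 1 + j))
          (s 0 (s 7 a)) (s 10 a) (s' 10 a))
    ?_ ?_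
  · exact ⟨fun a ha => this.1 a (by omega), fun a ha => this.2 a ha (by omega)⟩
  · simp [Memory.set_ne]
  · rintro i hi s' hfr h3 ⟨ih₁, ih₂⟩
    have h0 : s' 0 = s 0 := hfr 0 rfl
    have h2 : s' 2 = s 2 := hfr 2 rfl
    have h7 : s' 7 = s 7 := hfr 7 rfl
    have h8 : s' 8 = s 8 := hfr 8 rfl
    have h6 : s' 6 = s 6 := hfr 6 rfl
    have h11 : s' 11 = s 11 := hfr 11 rfl
    have hstay : (s 0 off ≤ i ∨ s 11 (s 8 i) ≤ s 6 (s 8 i)) →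
        (∀ a, (i + 1 ≤ a ∨ s 0 off ≤ a) ∨ s 11 (s 8 a) ≤ s 6 (s 8 a) → s' 10 a = s 10 a) ∧
      ∀ a < s 0 off, a < i + 1 → s 6 (s 8 a) < s 11 (s 8 a) →
        FirstWith (fun h => s 11 h < s 6 h) (fun j => s 0 (s 7 a + 1 + j))
          (s 0 (s 7 a)) (s 10 a) (s' 10 a) := by
      intro h
      refine ⟨fun a ha => ih₁ a (by omega), fun a ha hai hl => ih₂ a ha ?_ hl⟩
      by_contra hne
      obtain rfl : a = i := by omega
      omega
    simp only [Memory.set_ne, ne_eq, Nat.reduceEqDiff, not_false_eq_true, Code.den, eval_sub,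
      eval_get, eval_const, eval_var, h0, h3, h6, h8, h11]
    split_ifs with h₁ h₂
    · exact hstay (by omega)
    · exact hstay (by omega)
    · have hden := den_secondOf s' (by rw [h0, h7, h2, h3]; exact hk i (by omega))
      rw [h0, h3, h6, h7, h11] at hden
      refine ⟨fun a ha => ?_, fun a ha hai hl => ?_⟩
      · have hai : a ≠ i := by rintro rfl; omega
        rw [hden.1 a hai]
        exact ih₁ a (by omega)
      · by_cases hai' : a = i
        · subst hai'
          have := hden.2
          rwa [ih₁ a (by omega)] at this
        · rw [hden.1 a hai']
          exact ih₂ a ha (by omega) hl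

/-! ### The program: searching for augmenting paths. -/

/-- Mark the overloaded places. -/
def markInit : Code :=
  .rep 3 (.cond (.sub (.get 11 (var 3)) (.get 6 (var 3))) (.assign 12 (var 3) (.const 1))
    (.assign 12 (var 3) (.const 0)))

theorem den_markInit (s : Memory) :
    (∀ v, s 2 0 ≤ v → markInit.den s 12 v = s 12 v) ∧
    ∀ v < s 2 0, markInit.den s 12 v = if s 11 v - s 6 v ≠ 0 then 1 else 0 := by
  have := Code.den_rep_induction (v := 3) s
    (p := (.cond (.sub (.get 11 (var 3)) (.get 6 (var 3))) (.assign 12 (var 3) (.const 1))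
      (.assign 12 (var 3) (.const 0))))
    (fun i s' => (∀ v, i ≤ v → s' 12 v = s 12 v) ∧
      ∀ v < i, s' 12 v = if s 11 v - s 6 v ≠ 0 then 1 else 0)
    (by simp [Memory.set_ne]) ?_
  · exact this
  · rintro i hi s' hfr h3 ⟨ih₁, ih₂⟩
    have h6 : s' 6 = s 6 := hfr 6 rfl
    have h11 : s' 11 = s 11 := hfr 11 rfl
    simp only [Memory.set_ne, ne_eq, Nat.reduceEqDiff, not_false_eq_true, Code.den, eval_sub,
      eval_get, eval_const, eval_var, h3, h6, h11]
    have key : ∀ x, (x = if s 11 i - s 6 i ≠ 0 then 1 else 0) →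
        (∀ v, i + 1 ≤ v → s'.set 12 i x 12 v = s 12 v) ∧
        ∀ v < i + 1, s'.set 12 i x 12 v = if s 11 v - s 6 v ≠ 0 then 1 else 0 := by
      intro x hx
      rw [Memory.set_same]
      refine ⟨fun v hv => ?_, fun v hv => ?_⟩
      · rw [Function.update_of_ne (by omega)]
        exact ih₁ v (by omega)
      · by_cases hvi : v = i
        · subst hvi
          rw [Function.update_self, hx]
        · rw [Function.update_of_ne hvi]
          exact ih₂ v (by omega)
    split_ifs with h₁
    · exact key 0 (by simp [h₁])
    · exact key 1 (by simp [h₁])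

/-- Extend the search along all arcs. -/
def sweep : Code :=
  .rep 3 (.cond (.get 12 (.get 8 (var 3)))
    (.cond (.get 12 (.get 10 (var 3))) .skip
      (.assign 12 (.get 10 (var 3)) (.add (var 3) (.const 2)))) .skip)

variable {n L : ℕ} {F S q cur alt load R : ℕ → ℕ}

theorem den_sweep (s : Memory) {rk : ℕ → ℕ} (h : Conf n (s 2 0) F S (s 6) (s 8) (s 10) (s 11))
    (hn : n ≤ s 2 0) (hs : Search (s 2 0) (s 6) (s 8) (s 10) (s 11) (s 12) rk) :
    (∃ rk', Search (s 2 0) (s 6) (s 8) (s 10) (s 11) (sweep.den s 12) rk') ∧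
    ((sweep.den s 12 = s 12 ∧ Closed (s 8) (s 10) (s 12)) ∨
      ((supp (s 2 0) (s 12)).card < (supp (s 2 0) (sweep.den s 12)).card ∧
        ¬ Closed (s 8) (s 10) (s 12))) := by
  have := Code.den_rep_induction (v := 3) s
    (p := (.cond (.get 12 (.get 8 (var 3)))
      (.cond (.get 12 (.get 10 (var 3))) .skip
        (.assign 12 (.get 10 (var 3)) (.add (var 3) (.const 2)))) .skip))
    (fun i s' => (∃ rk', Search (s 2 0) (s 6) (s 8) (s 10) (s 11) (s' 12) rk') ∧
      ((s' 12 = s 12 ∧ ∀ a < i, s 12 (s 8 a) ≠ 0 → s 12 (s 10 a) ≠ 0) ∨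
      ((supp (s 2 0) (s 12)).card < (supp (s 2 0) (s' 12)).card ∧
        ¬ Closed (s 8) (s 10) (s 12))))
    ?_ ?_
  · obtain ⟨h₁, h₂⟩ := this
    refine ⟨h₁, h₂.imp (fun h₃ => ⟨h₃.1, fun a ha => ?_⟩) id⟩
    by_cases han : a < n
    · exact h₃.2 a (by omega) ha
    · rwa [← h.eq (not_lt.1 han)]
  · simpa [Memory.set_ne] using ⟨rk, hs⟩
  · rintro i hi s' hfr h3 ⟨⟨rk', ih₁⟩, ih₂⟩
    have h8 : s' 8 = s 8 := hfr 8 rfl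
    have h10 : s' 10 = s 10 := hfr 10 rfl
    simp only [Memory.set_ne, ne_eq, Nat.reduceEqDiff, not_false_eq_true, Code.den, eval_add,
      eval_get, eval_const, eval_var, h3, h8, h10]
    have hstay : (s' 12 (s 8 i) ≠ 0 → s' 12 (s 10 i) ≠ 0) →
        (∃ rk', Search (s 2 0) (s 6) (s 8) (s 10) (s 11) (s' 12) rk') ∧
        ((s' 12 = s 12 ∧ ∀ a < i + 1, s 12 (s 8 a) ≠ 0 → s 12 (s 10 a) ≠ 0) ∨
        ((supp (s 2 0) (s 12)).card < (supp (s 2 0) (s' 12)).card ∧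
          ¬ Closed (s 8) (s 10) (s 12))) := by
      intro hc
      refine ⟨⟨rk', ih₁⟩, ih₂.imp (fun h₃ => ⟨h₃.1, fun a ha => ?_⟩) id⟩
      by_cases hai : a = i
      · subst hai
        rwa [h₃.1] at hc
      · exact h₃.2 a (by omega)
    split_ifs with h₁ h₂
    · exact hstay fun h => absurd h₁ h
    · rw [Memory.set_same]
      obtain ⟨h₃, h₄⟩ := ih₁.step h h₁ h₂
      refine ⟨h₃, Or.inr ?_⟩
      rw [h₄]
      rcases ih₂ with ⟨h₅, -⟩ | ⟨h₅, h₆⟩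
      · rw [h₅] at h₁ h₂ ⊢
        exact ⟨by omega, fun hc => hc i h₁ h₂⟩
      · exact ⟨by omega, h₆⟩
    · exact hstay fun _ => h₂

/-- The search for a path from the overloaded places. -/
def search : Code := .seq markInit (.rep 4 sweep)

/-- A sweep that starts from marks that are not closed adds one, and there are only L places; hence
L sweeps reach a closed set, which later sweeps leave alone. -/
theorem den_search (s : Memory) (h : Conf n (s 2 0) F S (s 6) (s 8) (s 10) (s 11))
    (hn : n ≤ s 2 0) (h12 : ∀ v, s 2 0 ≤ v → s 12 v = 0) :
    (∃ rk, Search (s 2 0) (s 6) (s 8) (s 10) (s 11) (search.den s 12) rk) ∧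
      Closed (s 8) (s 10) (search.den s 12) := by
  rw [search, Code.den]
  set s₁ := markInit.den s with hs₁
  have hfr₁ : ∀ b, markInit.keeps b → s₁ b = s b := fun b hb => Code.den_of_keeps hb s
  have k2 : s₁ 2 = s 2 := hfr₁ 2 rfl
  have k6 : s₁ 6 = s 6 := hfr₁ 6 rfl
  have k8 : s₁ 8 = s 8 := hfr₁ 8 rfl
  have k10 : s₁ 10 = s 10 := hfr₁ 10 rfl
  have k11 : s₁ 11 = s 11 := hfr₁ 11 rfl
  have hinit := den_markInit s
  have hS := h.search_init (R := s₁ 12) (fun v hv => by rw [hs₁, hinit.1 v hv, h12 v hv]) hinit.2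
  have := Code.den_rep_induction (v := 4) s₁ (p := sweep)
    (fun i s' => (∃ rk, Search (s 2 0) (s 6) (s 8) (s 10) (s 11) (s' 12) rk) ∧
      (i ≤ (supp (s 2 0) (s' 12)).card ∨ Closed (s 8) (s 10) (s' 12)))
    ?_ ?_
  · obtain ⟨h₁, h₂⟩ := this
    refine ⟨h₁, h₂.elim (fun h₃ => ?_) id⟩
    rw [k2] at h₃
    exact h.closed_of_card h₃
  · simpa [Memory.set_ne] using ⟨_, hS⟩
  · rintro i hi s' hfr h4 ⟨⟨rk, ih₁⟩, ih₂⟩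
    have h2 : s' 2 = s 2 := (hfr 2 rfl).trans k2
    have h6 : s' 6 = s 6 := (hfr 6 rfl).trans k6
    have h8 : s' 8 = s 8 := (hfr 8 rfl).trans k8
    have h10 : s' 10 = s 10 := (hfr 10 rfl).trans k10
    have h11 : s' 11 = s 11 := (hfr 11 rfl).trans k11
    rw [Memory.set_ne _ _ _ (by norm_num)]
    have hsw := den_sweep (n := n) (F := F) (S := S) s' (rk := rk)
      (by rwa [h2, h6, h8, h10, h11]) (by rwa [h2]) (by rwa [h2, h6, h8, h10, h11])
    rw [h2, h6, h8, h10, h11] at hsw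
    refine ⟨hsw.1, ?_⟩
    rcases hsw.2 with ⟨h₁, h₂⟩ | ⟨h₁, h₂⟩
    · rw [h₁]; exact Or.inr h₂
    · have := ih₂.resolve_right h₂
      exact Or.inl (by omega)

/-- Find an underloaded place that is marked. -/
def target : Code :=
  .seq (.assign 13 (.const 0) (.const 0))
    (.rep 3 (.cond (.get 12 (var 3)) (.cond (.sub (.get 6 (var 3)) (.get 11 (var 3)))
      (.assign 13 (.const 0) (.add (var 3) (.const 1))) .skip) .skip))

theorem den_target (s : Memory) :
    (target.den s 13 0 = 0 ∧ ∀ v < s 2 0, s 12 v ≠ 0 → s 6 v ≤ s 11 v) ∨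
    ∃ v < s 2 0, target.den s 13 0 = v + 1 ∧ s 12 v ≠ 0 ∧ s 11 v < s 6 v := by
  rw [target, Code.den, Code.den]
  set s₁ := s.set 13 ((Expr.const 0).eval s) ((Expr.const 0).eval s) with hs₁
  have hfr₁ : ∀ b ≠ 13, s₁ b = s b := fun b hb => Memory.set_ne _ _ _ hb
  have := Code.den_rep_induction (v := 3) s₁
    (p := (.cond (.get 12 (var 3)) (.cond (.sub (.get 6 (var 3)) (.get 11 (var 3)))
      (.assign 13 (.const 0) (.add (var 3) (.const 1))) .skip) .skip))
    (fun i s' => (s' 13 0 = 0 ∧ ∀ v < i, s 12 v ≠ 0 → s 6 v ≤ s 11 v) ∨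
      ∃ v < s 2 0, s' 13 0 = v + 1 ∧ s 12 v ≠ 0 ∧ s 11 v < s 6 v)
    ?_ ?_
  · rw [hfr₁ 2 (by norm_num)] at this
    exact this
  · refine Or.inl ?_
    simp [Memory.set_ne, hs₁]
  · intro i hi s' hfr h3 ih
    rw [hfr₁ 2 (by norm_num)] at hi
    have h6 : s' 6 = s 6 := (hfr 6 rfl).trans (hfr₁ 6 (by norm_num))
    have h11 : s' 11 = s 11 := (hfr 11 rfl).trans (hfr₁ 11 (by norm_num))
    have h12 : s' 12 = s 12 := (hfr 12 rfl).trans (hfr₁ 12 (by norm_num))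
    have hstay : (s 12 i ≠ 0 → s 6 i ≤ s 11 i) →
        (s' 13 0 = 0 ∧ ∀ v < i + 1, s 12 v ≠ 0 → s 6 v ≤ s 11 v) ∨
        ∃ v < s 2 0, s' 13 0 = v + 1 ∧ s 12 v ≠ 0 ∧ s 11 v < s 6 v := by
      refine fun h => ih.imp (fun h' => ⟨h'.1, fun v hv => ?_⟩) id
      by_cases hvi : v = i
      · subst hvi; exact h
      · exact h'.2 v (by omega)
    simp only [Memory.set_ne, ne_eq, Nat.reduceEqDiff, not_false_eq_true, Code.den, eval_add,
      eval_sub, eval_get, eval_const, eval_var, h3, h6, h11, h12]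
    split_ifs with h₁ h₂
    · exact hstay fun h => absurd h₁ h
    · exact hstay fun _ => by omega
    · refine Or.inr ⟨i, hi, ?_, h₁, by omega⟩
      rw [Memory.set_same, Function.update_self]

end HouseProgram

namespace Rebalance

variable {n L : ℕ} {F S q cur alt load R rk : ℕ → ℕ}

/-- In an optimal configuration, the search marks no underloaded place. -/
theorem Search.le_of_optimal (hs : Search L q cur alt load R rk) (ho : Optimal q cur alt load)
    {v : ℕ} (hv : R v ≠ 0) : q v ≤ load v := by
  obtain ⟨Z, h₁, h₂, h₃⟩ := ho
  suffices ∀ k v, rk v = k → R v ≠ 0 → v ∈ Z from h₃ v (this _ v rfl hv)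
  intro k
  induction k using Nat.strong_induction_on with
  | _ k ih =>
    intro v hk hv
    by_cases hv1 : R v = 1
    · exact h₂ v ((hs.root v).1 hv1)
    · obtain ⟨h₄, h₅, h₆⟩ := hs.arc v (by omega)
      rw [← h₄]
      exact h₁ _ (ih _ (by omega) _ rfl h₅)

end Rebalance

namespace HouseProgram

open RAM Rebalance

variable {n : ℕ} {F S : ℕ → ℕ}

/-! ### The program: augmentation rounds. -/

/-- Move the items along the path that leads to the house in cell `14`. -/
def reverse : Code :=
  .rep 3 (.cond (.sub (.get 12 (var 14)) (.const 1))
    (.seq (.assign 15 (.const 0) (.sub (.get 12 (var 14)) (.const 2)))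
      (.seq (.assign 9 (.const 0) (.get 8 (var 15)))
        (.seq (.assign 8 (var 15) (var 14))
          (.seq (.assign 10 (var 15) (var 9)) (.assign 14 (.const 0) (var 9)))))) .skip)

/-- Each reversed arc lowers the rank, which is below L at the start, so L rounds end at a root;
once there, the body does nothing. -/
theorem den_reverse (s : Memory) {rk : ℕ → ℕ} (h : Conf n (s 2 0) F S (s 6) (s 8) (s 10) (s 11))
    (hs : Search (s 2 0) (s 6) (s 8) (s 10) (s 11) (s 12) rk) (ht : s 12 (s 14 0) ≠ 0) :
    Trace n F S (s 11) (s 12) rk (s 8) (s 14 0) (reverse.den s 8) (reverse.den s 10)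
      (reverse.den s 14 0) ∧ s 12 (reverse.den s 14 0) = 1 := by
  have := Code.den_rep_induction (v := 3) s
    (p := .cond (.sub (.get 12 (var 14)) (.const 1))
    (.seq (.assign 15 (.const 0) (.sub (.get 12 (var 14)) (.const 2)))
      (.seq (.assign 9 (.const 0) (.get 8 (var 15)))
        (.seq (.assign 8 (var 15) (var 14))
          (.seq (.assign 10 (var 15) (var 9)) (.assign 14 (.const 0) (var 9)))))) .skip)
    (fun i s' => Trace n F S (s 11) (s 12) rk (s 8) (s 14 0) (s' 8) (s' 10) (s' 14 0) ∧
      (s 12 (s' 14 0) = 1 ∨ rk (s' 14 0) + i ≤ rk (s 14 0)))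
    ?_ ?_
  · obtain ⟨h₁, h₂⟩ := this
    refine ⟨h₁, h₂.resolve_right fun h₃ => ?_⟩
    have h₄ := hs.rk_lt _ ht
    have h₅ := hs.card_le
    omega
  · simp only [Memory.set_ne, ne_eq, Nat.reduceEqDiff, not_false_eq_true]
    exact ⟨hs.trace_init h ht, Or.inr le_rfl⟩
  · rintro i hi s' hfr h3 ⟨ih₁, ih₂⟩
    have h12 : s' 12 = s 12 := hfr 12 rfl
    simp only [Memory.set_ne, ne_eq, Nat.reduceEqDiff, not_false_eq_true, Code.den, eval_sub,
      eval_get, eval_const, eval_var, h12]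
    have hm := ih₁.mark
    split_ifs with h₁
    · exact ⟨ih₁, Or.inl (by omega)⟩
    · simp only [Memory.set_ne, Memory.set_same, ne_eq, Nat.reduceEqDiff, not_false_eq_true,
        Function.update_self]
      obtain ⟨h₂, h₃⟩ := ih₁.step hs h (by omega)
      exact ⟨h₂, Or.inr (by omega)⟩

/-- Move one unit of load along a path to the house found by the search, if there is one. -/
def augment : Code :=
  .cond (var 13)
    (.seq (.assign 14 (.const 0) (.sub (var 13) (.const 1)))
      (.seq reverse
        (.seq (.assign 11 (.sub (var 13) (.const 1))
            (.add (.get 11 (.sub (var 13) (.const 1))) (.const 1)))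
          (.assign 11 (var 14) (.sub (.get 11 (var 14)) (.const 1))))))
    .skip

/-- One round: search for a path and move one unit of load along it. -/
def round : Code := .seq search (.seq target augment)

/-- An augmentation refutes optimality by `Search.le_of_optimal`. This is recorded so that, in
`den_balance`, a configuration once optimal stays fixed and otherwise all earlier rounds have
reduced the excess. -/
theorem den_round (s : Memory) (h : Conf n (s 2 0) F S (s 6) (s 8) (s 10) (s 11))
    (hn : n ≤ s 2 0) (h12 : ∀ v, s 2 0 ≤ v → s 12 v = 0) :
    (∀ v, s 2 0 ≤ v → round.den s 12 v = 0) ∧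
    ((Conf n (s 2 0) F S (s 6) (round.den s 8) (round.den s 10) (round.den s 11) ∧
        excess (s 2 0) (s 6) (round.den s 11) + 1 = excess (s 2 0) (s 6) (s 11) ∧
        ¬ Optimal (s 6) (s 8) (s 10) (s 11)) ∨
      (round.den s 8 = s 8 ∧ round.den s 10 = s 10 ∧ round.den s 11 = s 11 ∧
        Optimal (s 6) (s 8) (s 10) (s 11))) := by
  obtain ⟨⟨rk, hs⟩, hc⟩ := den_search s h hn h12
  rw [round, Code.den, Code.den]
  set s₁ := search.den s with hs₁
  have hfr₁ : ∀ b, search.keeps b → s₁ b = s b := fun b hb => Code.den_of_keeps hb s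
  have htg := den_target s₁
  set s₂ := target.den s₁ with hs₂
  have hfr₂ : ∀ b, target.keeps b → s₂ b = s₁ b := fun b hb => Code.den_of_keeps hb s₁
  have k2 : s₂ 2 = s 2 := (hfr₂ 2 rfl).trans (hfr₁ 2 rfl)
  have k6 : s₂ 6 = s 6 := (hfr₂ 6 rfl).trans (hfr₁ 6 rfl)
  have k8 : s₂ 8 = s 8 := (hfr₂ 8 rfl).trans (hfr₁ 8 rfl)
  have k10 : s₂ 10 = s 10 := (hfr₂ 10 rfl).trans (hfr₁ 10 rfl)
  have k11 : s₂ 11 = s 11 := (hfr₂ 11 rfl).trans (hfr₁ 11 rfl)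
  have k12 : s₂ 12 = s₁ 12 := hfr₂ 12 rfl
  have hkeep : augment.den s₂ 12 = s₁ 12 := (Code.den_of_keeps rfl s₂).trans k12
  rw [hfr₁ 2 rfl, hfr₁ 6 rfl, hfr₁ 11 rfl] at htg
  rw [hkeep]
  refine ⟨hs.zero, ?_⟩
  rcases htg with ⟨h13, hno⟩ | ⟨t, htL, h13, ht, htq⟩
  · right
    have hden : augment.den s₂ = s₂ := by
      rw [augment, Code.den, if_pos (by simpa using h13), Code.den]
    rw [hden, k8, k10, k11]
    refine ⟨rfl, rfl, rfl, hs.optimal hc fun v hv => hno v ?_ hv⟩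
    by_contra h'
    exact hv (hs.zero v (not_lt.1 h'))
  · left
    have h13' : s₂ 13 0 ≠ 0 := by omega
    rw [augment, Code.den, if_neg (by simpa using h13')]
    simp only [Code.den, eval_sub, eval_var, eval_const, h13, Nat.add_sub_cancel]
    set s₃ := s₂.set 14 0 t with hs₃
    have hfr₃ : ∀ b ≠ 14, s₃ b = s₂ b := fun b hb => Memory.set_ne _ _ _ hb
    have h14 : s₃ 14 0 = t := by rw [hs₃, Memory.set_same, Function.update_self]
    have j2 : s₃ 2 = s 2 := (hfr₃ 2 (by norm_num)).trans k2
    have j6 : s₃ 6 = s 6 := (hfr₃ 6 (by norm_num)).trans k6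
    have j8 : s₃ 8 = s 8 := (hfr₃ 8 (by norm_num)).trans k8
    have j10 : s₃ 10 = s 10 := (hfr₃ 10 (by norm_num)).trans k10
    have j11 : s₃ 11 = s 11 := (hfr₃ 11 (by norm_num)).trans k11
    have j12 : s₃ 12 = s₁ 12 := (hfr₃ 12 (by norm_num)).trans k12
    have j13 : s₃ 13 = s₂ 13 := hfr₃ 13 (by norm_num)
    have hrev := den_reverse (n := n) (F := F) (S := S) s₃ (rk := rk)
      (by rwa [j2, j6, j8, j10, j11]) (by rwa [j2, j6, j8, j10, j11, j12])
      (by rwa [h14, j12])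
    rw [h14, j8, j11, j12] at hrev
    obtain ⟨htr, hroot⟩ := hrev
    set s₄ := reverse.den s₃ with hs₄
    have i11 : s₄ 11 = s 11 := (Code.den_of_keeps rfl s₃).trans j11
    have i13 : s₄ 13 0 = t + 1 := by
      rw [hs₄, Code.den_of_keeps rfl s₃, j13, h13]
    have hfin := htr.finish hs h hroot htq rfl
    simp only [Memory.set_ne, Memory.set_same, ne_eq, Nat.reduceEqDiff, not_false_eq_true,
      eval_get, eval_add, eval_sub, eval_var, eval_const, i11, i13, Nat.add_sub_cancel]
    refine ⟨hfin.1, hfin.2, fun ho => ?_⟩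
    have := hs.le_of_optimal ho ht
    omega

/-- Move load as long as possible. -/
def balance : Code := .rep 5 round

/-- The excess is at most n initially, and at least n rounds are made. If none of them met an
optimal configuration, the excess is zero, which is optimal with an empty cut. -/
theorem den_balance (s : Memory) (h : Conf n (s 2 0) F S (s 6) (s 8) (s 10) (s 11))
    (hn : n ≤ s 2 0) (h12 : s 12 = 0) :
    Conf n (s 2 0) F S (s 6) (balance.den s 8) (balance.den s 10) (balance.den s 11) ∧
      Optimal (s 6) (balance.den s 8) (balance.den s 10) (balance.den s 11) := by
  have := Code.den_rep_induction (v := 5) s (p := round)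
    (fun i s' => (∀ v, s 2 0 ≤ v → s' 12 v = 0) ∧
      Conf n (s 2 0) F S (s 6) (s' 8) (s' 10) (s' 11) ∧
      (excess (s 2 0) (s 6) (s' 11) + i ≤ n ∨ Optimal (s 6) (s' 8) (s' 10) (s' 11)))
    ?_ ?_
  · obtain ⟨-, h₁, h₂⟩ := this
    refine ⟨h₁, h₂.elim (fun h₃ => h₁.optimal_of_excess ?_) id⟩
    omega
  · simp only [Memory.set_ne, ne_eq, Nat.reduceEqDiff, not_false_eq_true, h12]
    exact ⟨fun _ _ => rfl, h, Or.inl h.excess_le⟩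
  · rintro i hi s' hfr h5 ⟨ih₁, ih₂, ih₃⟩
    have h2 : s' 2 = s 2 := hfr 2 rfl
    have h6 : s' 6 = s 6 := hfr 6 rfl
    have hr := den_round (n := n) (F := F) (S := S) s' (by rwa [h2, h6]) (by rwa [h2])
      (by rwa [h2])
    rw [h2, h6] at hr
    simp only [Memory.set_ne, ne_eq, Nat.reduceEqDiff, not_false_eq_true]
    refine ⟨hr.1, ?_⟩
    rcases hr.2 with ⟨h₁, h₂, h₃⟩ | ⟨h₁, h₂, h₃, h₄⟩
    · exact ⟨h₁, Or.inl (by have := ih₃.resolve_right h₃; omega)⟩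
    · rw [h₁, h₂, h₃]
      exact ⟨ih₂, Or.inr h₄⟩

/-! ### The complete algorithm, run on an abstract input. -/

/-- Read the instance at position `off` of the input and compute an optimal assignment. -/
def solve (off : ℕ) : Code :=
  .seq (readCaps off) (.seq (readPos off) (.seq (readEmpty off) (.seq (readFirst off)
    (.seq (readSecond off) balance))))

/-- The input `w` contains at position `off` an instance with `n` applicants, `m` houses, the
capacities `q` (extended by zero), and the preference lists `u a 0, ..., u a (k a - 1)`. -/
structure Encodes (w : ℕ → ℕ) (off n m : ℕ) (q k : ℕ → ℕ) (u : ℕ → ℕ → ℕ) : Prop where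
  applicants : w off = n
  houses : w (off + 1) = m
  caps : ∀ v, q v = if v < m then w (off + 2 + v) else 0
  length : ∀ a < n, w (posn w (off + 2 + m) a) = k a
  entry : ∀ a < n, ∀ j, u a j = w (posn w (off + 2 + m) a + 1 + j)
  length_le : ∀ a < n, k a ≤ m
  entry_lt : ∀ a < n, ∀ j < k a, u a j < m

theorem den_solve {w : List ℕ} {off n m : ℕ} {q k : ℕ → ℕ} {u : ℕ → ℕ → ℕ}
    (hw : Encodes (fun i => w.getD i 0) off n m q k u) :
    ((solve off).den (start off w) 16 0 ≠ 0 ↔ ∃ a < n, k a = 0) ∧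
    (solve off).den (start off w) 6 = q ∧
    ((∀ a < n, 0 < k a) → ∃ F S : ℕ → ℕ, (∀ a < n, F a = u a 0) ∧
      (∀ a < n, cnt n F (F a) ≤ q (F a) → S a = F a) ∧
      (∀ a < n, q (F a) < cnt n F (F a) →
        FirstWith (fun h => cnt n F h < q h) (u a) (k a) (F a) (S a)) ∧
      Conf n (n + m) F S q ((solve off).den (start off w) 8)
        ((solve off).den (start off w) 10) ((solve off).den (start off w) 11) ∧
      Optimal q ((solve off).den (start off w) 8) ((solve off).den (start off w) 10)
        ((solve off).den (start off w) 11)) := by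
  set s := start off w with hs
  have e0 : s 0 = fun i => w.getD i 0 := by
    rw [hs, start, Memory.set_ne _ _ _ (by norm_num)]
    funext i
    simp [init]
  have e0n : s 0 off = n := by rw [e0]; exact hw.applicants
  have e0m : s 0 (off + 1) = m := by rw [e0]; exact hw.houses
  have e2 : s 2 0 = n + m := by
    rw [← e0n, ← e0m, e0, hs, start, Memory.set_same, Function.update_self]
  have ez : ∀ b, b ≠ 2 → b ≠ 0 → s b = 0 := by
    intro b h2 h0
    rw [hs, start, Memory.set_ne _ _ _ h2]
    funext i
    simp [init, h0]
  simp only [solve, Code.den]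
  have d₁ := den_readCaps off s (ez 6 (by norm_num) (by norm_num)) (by omega)
  set s₁ := (readCaps off).den s with hs₁
  have f₁ : ∀ b, (readCaps off).keeps b → s₁ b = s b := fun b hb => Code.den_of_keeps hb s
  have d₂ := den_readPos off s₁ (by rw [f₁ 0 rfl, f₁ 2 rfl]; omega)
  set s₂ := (readPos off).den s₁ with hs₂
  have f₂ : ∀ b, (readPos off).keeps b → s₂ b = s₁ b := fun b hb => Code.den_of_keeps hb s₁
  have d₃ := den_readEmpty off s₂
    (by rw [f₂ 16 rfl, f₁ 16 rfl]; exact ez 16 (by norm_num) (by norm_num))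
    (by rw [f₂ 0 rfl, f₁ 0 rfl, f₂ 2 rfl, f₁ 2 rfl]; omega)
  set s₃ := (readEmpty off).den s₂ with hs₃
  have f₃ : ∀ b, (readEmpty off).keeps b → s₃ b = s₂ b := fun b hb => Code.den_of_keeps hb s₂
  have z₃ : ∀ b, (readEmpty off).keeps b → (readPos off).keeps b → (readCaps off).keeps b →
      s₃ b = s b := fun b h h' h'' => by rw [f₃ b h, f₂ b h', f₁ b h'']
  have d₄ := den_readFirst off s₃ (by rw [z₃ 8 rfl rfl rfl]; exact ez 8 (by norm_num) (by norm_num))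
    (by rw [z₃ 10 rfl rfl rfl]; exact ez 10 (by norm_num) (by norm_num))
    (by rw [z₃ 11 rfl rfl rfl]; exact ez 11 (by norm_num) (by norm_num))
    (by rw [z₃ 0 rfl rfl rfl, z₃ 2 rfl rfl rfl]; omega)
  set s₄ := (readFirst off).den s₃ with hs₄
  have f₄ : ∀ b, (readFirst off).keeps b → s₄ b = s₃ b := fun b hb => Code.den_of_keeps hb s₃
  have p₄ : ∀ a ≤ n, s₃ 7 a = posn (s 0) (off + 2 + m) a := fun a ha => by
    rw [f₃ 7 rfl, d₂ a (by rw [f₁ 0 rfl]; omega), f₁ 0 rfl, e0m]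
  have p₀ : ∀ a < n, s 0 (posn (s 0) (off + 2 + m) a) = k a := fun a ha => by
    rw [e0]; exact hw.length a ha
  have p₁ : ∀ a < n, ∀ j, s 0 (posn (s 0) (off + 2 + m) a + 1 + j) = u a j := fun a ha j => by
    rw [e0]; exact (hw.entry a ha j).symm
  have z40 : s₄ 0 = s 0 := by rw [f₄ 0 rfl, z₃ 0 rfl rfl rfl]
  have z42 : s₄ 2 = s 2 := by rw [f₄ 2 rfl, z₃ 2 rfl rfl rfl]
  have q₄ : s₄ 6 = q := by
    rw [f₄ 6 rfl, f₃ 6 rfl, f₂ 6 rfl]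
    funext v
    rw [d₁, hw.caps, e0m, e0]
  have d₅ := den_readSecond off s₄
    (fun a ha => by
      rw [z40, e0n] at ha
      rw [z40, z42, f₄ 7 rfl, p₄ a ha.le, p₀ a ha]
      have := hw.length_le a ha
      omega) (by rw [z40, z42]; omega)
  set s₅ := (readSecond off).den s₄ with hs₅
  have f₅ : ∀ b, (readSecond off).keeps b → s₅ b = s₄ b := fun b hb => Code.den_of_keeps hb s₄
  set s₆ := balance.den s₅ with hs₆
  have f₆ : ∀ b, balance.keeps b → s₆ b = s₅ b := fun b hb => Code.den_of_keeps hb s₅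
  refine ⟨?_, ?_, fun hpos => ?_⟩
  · rw [f₆ 16 rfl, f₅ 16 rfl, f₄ 16 rfl, d₃, f₂ 0 rfl, f₁ 0 rfl, e0n]
    refine exists_congr fun a => and_congr_right fun ha => ?_
    rw [← f₃ 7 rfl, p₄ a ha.le, p₀ a ha]
  · rw [f₆ 6 rfl, f₅ 6 rfl, q₄]
  · rw [z₃ 0 rfl rfl rfl, e0n] at d₄
    rw [z40, e0n, q₄] at d₅
    obtain ⟨d₄a, d₄b, d₄c⟩ := d₄
    obtain ⟨d₅a, d₅b⟩ := d₅
    have hF : ∀ a < n, s₄ 8 a = u a 0 := fun a ha => by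
      rw [d₄a, if_pos ha, p₄ a ha.le, ← p₁ a ha 0, Nat.add_zero]
    have hl : s₄ 11 = fun v => cnt n (s₄ 8) v := funext d₄c
    have hF0 : ∀ a, n ≤ a → s₄ 8 a = 0 := fun a ha => by rw [d₄a, if_neg (by omega)]
    have h10 : s₄ 10 = s₄ 8 := d₄b
    rw [hl, h10] at d₅a d₅b
    have hsec : ∀ a < n, q (s₄ 8 a) < cnt n (s₄ 8) (s₄ 8 a) →
        FirstWith (fun h => cnt n (s₄ 8) h < q h) (u a) (k a) (s₄ 8 a) (s₅ 10 a) := by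
      intro a ha hlt
      have := d₅b a ha hlt
      rw [f₄ 7 rfl, p₄ a ha.le, p₀ a ha] at this
      simp only [p₁ a ha] at this
      exact this
    have hltF : ∀ a < n, s₄ 8 a < m := fun a ha => by
      rw [hF a ha]; exact hw.entry_lt a ha 0 (hpos a ha)
    have g2 : s₅ 2 0 = n + m := by rw [f₅ 2 rfl, z42, e2]
    have hconf : Conf n (s₅ 2 0) (s₄ 8) (s₅ 10) (s₅ 6) (s₅ 8) (s₅ 10) (s₅ 11) := by
      rw [g2, f₅ 6 rfl, q₄, f₅ 8 rfl, f₅ 11 rfl, hl]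
      refine ⟨fun a => Or.inl ⟨rfl, rfl⟩, fun v => rfl, fun v hv => hv, fun v hv => hv,
        fun a ha => ?_, fun a ha => ⟨by have := hltF a ha; omega, ?_⟩⟩
      · exact (d₅a a (Or.inl ha)).symm
      · by_cases hc : q (s₄ 8 a) < cnt n (s₄ 8) (s₄ 8 a)
        · rcases hsec a ha hc with ⟨-, h⟩ | ⟨j, hj, h, -⟩
          · rw [h]; have := hltF a ha; omega
          · rw [h]; have := hw.entry_lt a ha j hj; omega
        · rw [d₅a a (Or.inr (not_lt.1 hc))]; have := hltF a ha; omega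
    have z512 : s₅ 12 = 0 := by
      rw [f₅ 12 rfl, f₄ 12 rfl, z₃ 12 rfl rfl rfl]; exact ez 12 (by norm_num) (by norm_num)
    have hb := den_balance s₅ hconf (by omega) z512
    rw [g2, f₅ 6 rfl, q₄] at hb
    exact ⟨s₄ 8, s₅ 10, hF, fun a _ hle => d₅a a (Or.inr hle), hsec, hb.1, hb.2⟩

end HouseProgram

/-! ### Decoding the input, and correctness of the algorithm. -/

namespace HouseProgram

open RAM Rebalance

/-- Each block starts with its length, so jumping from header to header arrives at the total length
of the preceding blocks. -/
theorem posn_blocks (hd : List ℕ) (ls : List (List ℕ)) (a : ℕ) (ha : a ≤ ls.length) :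
    posn (fun i => (hd ++ (ls.map fun l => l.length :: l).flatten).getD i 0) hd.length a =
      (hd ++ ((ls.take a).map fun l => l.length :: l).flatten).length ∧
    ∀ h : a < ls.length,
      (hd ++ (ls.map fun l => l.length :: l).flatten).getD
        (hd ++ ((ls.take a).map fun l => l.length :: l).flatten).length 0 = ls[a].length ∧
      ∀ j (hj : j < ls[a].length), (hd ++ (ls.map fun l => l.length :: l).flatten).getD
        ((hd ++ ((ls.take a).map fun l => l.length :: l).flatten).length + 1 + j) 0 = ls[a][j] := by
  have hget : ∀ a, ∀ h : a < ls.length,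
      (hd ++ (ls.map fun l => l.length :: l).flatten).getD
        (hd ++ ((ls.take a).map fun l => l.length :: l).flatten).length 0 = ls[a].length ∧
      ∀ j (hj : j < ls[a].length), (hd ++ (ls.map fun l => l.length :: l).flatten).getD
        ((hd ++ ((ls.take a).map fun l => l.length :: l).flatten).length + 1 + j) 0 =
          ls[a][j] := by
    intro a h
    have hsplit : hd ++ (ls.map fun l => l.length :: l).flatten =
        (hd ++ ((ls.take a).map fun l => l.length :: l).flatten) ++
          ((ls[a].length :: ls[a]) ++ ((ls.drop (a + 1)).map fun l => l.length :: l).flatten) := by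
      have e : (ls.map fun l => l.length :: l) = ((ls.take a).map fun l => l.length :: l) ++
          (ls[a].length :: ls[a]) :: (ls.drop (a + 1)).map fun l => l.length :: l := by
        rw [← List.map_cons (f := fun l : List ℕ => l.length :: l), ← List.map_append,
          ← List.drop_eq_getElem_cons h, List.take_append_drop]
      rw [e]
      simp only [List.flatten_append, List.flatten_cons, List.append_assoc]
    rw [hsplit]
    refine ⟨?_, fun j hj => ?_⟩
    · rw [List.getD_append_right _ _ _ _ le_rfl]
      simp
    · rw [List.getD_append_right _ _ _ _ (by omega), List.getD_append _ _ _ _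
        (by simp only [List.length_cons]; omega),
        show ∀ x : ℕ, x + 1 + j - x = j + 1 by intro x; omega]
      simp [hj]
  refine ⟨?_, hget a⟩
  induction a with
  | zero => simp [posn]
  | succ a ih =>
    have ih' := ih (by omega)
    rw [posn, ih', (hget a (by omega)).1, List.take_succ_eq_append_getElem (by omega)]
    simp only [List.map_append, List.flatten_append, List.length_append, List.map_cons,
      List.map_nil, List.flatten_cons, List.flatten_nil, List.append_nil, List.length_cons]
    omega

theorem encode_eq (I : HouseInstance) : I.encode = ([I.n, I.m] ++ List.ofFn I.cap) ++
    ((List.ofFn fun a => (I.pref a).map Fin.val).map fun l => l.length :: l).flatten := by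
  rw [HouseInstance.encode, List.map_ofFn]
  congr 3
  funext a
  simp

/-- The capacities, extended by zero. -/
def capOf (I : HouseInstance) (v : ℕ) : ℕ := if h : v < I.m then I.cap ⟨v, h⟩ else 0

/-- The lengths of the preference lists. -/
def lengthOf (I : HouseInstance) (a : ℕ) : ℕ := if h : a < I.n then (I.pref ⟨a, h⟩).length else 0

/-- The word of the input at position `j` of the preference list of applicant `a`. -/
def entryOf (I : HouseInstance) (pre : List ℕ) (a j : ℕ) : ℕ :=
  (pre ++ I.encode).getD
    (posn (fun i => (pre ++ I.encode).getD i 0) (pre.length + 2 + I.m) a + 1 + j) 0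

theorem posn_encode (I : HouseInstance) (pre : List ℕ) (a : Fin I.n) :
    (pre ++ I.encode).getD
      (posn (fun i => (pre ++ I.encode).getD i 0) (pre.length + 2 + I.m) a) 0 =
      (I.pref a).length ∧
    ∀ j (hj : j < (I.pref a).length), entryOf I pre a j = ((I.pref a)[j] : Fin I.m) := by
  obtain ⟨h₁, h₂⟩ := posn_blocks (pre ++ ([I.n, I.m] ++ List.ofFn I.cap))
    (List.ofFn fun a => (I.pref a).map Fin.val) a (by simp)
  obtain ⟨h₂, h₃⟩ := h₂ (by simp)
  rw [← h₁] at h₂ h₃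
  have hlen : (pre ++ ([I.n, I.m] ++ List.ofFn I.cap)).length = pre.length + 2 + I.m := by
    simp; omega
  simp only [hlen, List.append_assoc pre, ← encode_eq, List.getElem_ofFn, Fin.eta,
    List.length_map, List.getElem_map] at h₂ h₃
  exact ⟨h₂, h₃⟩

theorem encodes (I : HouseInstance) (pre : List ℕ) :
    Encodes (fun i => (pre ++ I.encode).getD i 0) pre.length I.n I.m (capOf I) (lengthOf I)
      (entryOf I pre) where
  applicants := by simp [HouseInstance.encode]
  houses := by
    rw [List.getD_append_right _ _ _ _ (by omega)]
    simp [HouseInstance.encode]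
  caps v := by
    rw [List.getD_append_right _ _ _ _ (by omega),
      show pre.length + 2 + v - pre.length = v + 2 by omega, capOf]
    split_ifs with h
    · have e : I.encode.getD (v + 2) 0 = (List.ofFn I.cap ++
          (List.ofFn fun a => (I.pref a).length :: (I.pref a).map Fin.val).flatten).getD v 0 := rfl
      rw [e, List.getD_append _ _ _ _ (by simpa using h)]
      simp [h]
    · rfl
  length a ha := by
    rw [lengthOf, dif_pos ha]
    exact (posn_encode I pre ⟨a, ha⟩).1
  entry a ha j := rfl
  length_le a ha := by
    rw [lengthOf, dif_pos ha]
    simpa using (I.pref_nodup ⟨a, ha⟩).length_le_card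
  entry_lt a ha j hj := by
    rw [lengthOf, dif_pos ha] at hj
    rw [(posn_encode I pre ⟨a, ha⟩).2 j hj]
    exact Fin.is_lt _

/-- Each house has a capacity word and each applicant a length word. So n + m is bounded by the
number of words, although the capacities themselves may be exponential in the input size. -/
theorem le_inputSize (I : HouseInstance) (pre : List ℕ) :
    I.n + I.m ≤ inputSize (pre ++ I.encode) := by
  refine le_trans ?_ (length_le_inputSize _)
  have h : I.n ≤
      ((List.ofFn fun a => (I.pref a).length :: (I.pref a).map Fin.val).flatten).length := by
    rw [List.length_flatten, List.map_ofFn, List.sum_ofFn]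
    calc I.n = ∑ _a : Fin I.n, 1 := by simp
      _ ≤ _ := Finset.sum_le_sum fun a _ => by simp
  simp only [HouseInstance.encode, List.length_append, List.length_ofFn]
  omega

theorem cnt_eq_load {n m : ℕ} {G : ℕ → ℕ} {g : Fin n → Fin m} (h : ∀ a : Fin n, G a = g a)
    (v : Fin m) :
    cnt n G v = HouseInstance.load g v := by
  rw [cnt, HouseInstance.load, Finset.card_filter, Finset.card_filter, Finset.sum_range]
  refine Finset.sum_congr rfl fun a _ => if_congr ?_ rfl rfl
  rw [h, Fin.ext_iff]

/-- List order is preference order, so the first hit is the best. Its uniqueness lets the cut, which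
is closed for the computed second houses, satisfy the lower bound's condition on every second house.
-/
theorem isSecond_of_firstWith {I : HouseInstance} {pre : List ℕ} {f : Fin I.n → Fin I.m}
    {a : Fin I.n} {y x : ℕ} {P : ℕ → Prop}
    (hP : ∀ h : Fin I.m, P h ↔ HouseInstance.load f h < I.cap h)
    (hx : FirstWith P (entryOf I pre a) (I.pref a).length y x) :
    ((∀ k, ¬ I.IsSecond f a k) ∧ x = y) ∨
      ∃ k : Fin I.m, x = k ∧ I.IsSecond f a k ∧ ∀ k', I.IsSecond f a k' → k' = k := by
  have he := (posn_encode I pre a).2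
  rcases hx with ⟨h, rfl⟩ | ⟨j, hj, rfl, h₁, h₂⟩
  · refine Or.inl ⟨fun k hk => ?_, rfl⟩
    obtain ⟨i, hi, rfl⟩ := List.getElem_of_mem hk.1
    refine h i hi ?_
    rw [he i hi, hP]
    exact hk.2.1
  · right
    rw [he j hj] at h₁ ⊢
    have hsec : I.IsSecond f a (I.pref a)[j] := by
      refine ⟨List.getElem_mem hj, (hP _).1 h₁, fun h hh hl => ?_⟩
      obtain ⟨i, hi, rfl⟩ := List.getElem_of_mem hh
      rw [(I.pref_nodup a).idxOf_getElem, (I.pref_nodup a).idxOf_getElem]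
      by_contra hlt
      refine h₂ i (not_le.1 hlt) ?_
      rw [he i hi, hP]
      exact hl
    refine ⟨_, rfl, hsec, fun k' hk' => ?_⟩
    exact (List.idxOf_inj hk'.1).1
      (le_antisymm (hk'.2.2 _ hsec.1 hsec.2.1) (hsec.2.2 _ hk'.1 hk'.2.1))

/-- The program computes an optimal solution if all preference lists are nonempty. -/
theorem solve_correct (I : HouseInstance) (pre : List ℕ) (hne : ∀ a, I.pref a ≠ []) :
    ∃ g : Fin I.n → Fin I.m,
      (∀ a : Fin I.n, (solve pre.length).den (start pre.length (pre ++ I.encode)) 8 a = g a) ∧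
      (∀ h : Fin I.m, (solve pre.length).den (start pre.length (pre ++ I.encode)) 11 h =
        HouseInstance.load g h) ∧
      (∀ v, I.m ≤ v → (solve pre.length).den (start pre.length (pre ++ I.encode)) 11 v = 0) ∧
      (I.increase fun h => HouseInstance.load g h - I.cap h).IsPopular (fun a => some (g a)) ∧
      ∀ r, I.IsGoodIncrease r → ∑ h, (HouseInstance.load g h - I.cap h) ≤ ∑ h, r h := by
  classical
  obtain ⟨-, -, h⟩ := den_solve (encodes I pre)
  obtain ⟨F, S, hF, hS, hS', hc, ho⟩ := h fun a ha => by
    rw [lengthOf, dif_pos ha]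
    exact List.length_pos_iff.2 (hne _)
  generalize (solve pre.length).den (start pre.length (pre ++ I.encode)) = s at *
  have hcap : ∀ h : Fin I.m, capOf I h = I.cap h := fun h => by simp [capOf]
  let f : Fin I.n → Fin I.m := fun a => (I.pref a).head (hne a)
  have hf : I.IsFirst f := fun a => List.head?_eq_some_head (hne a)
  have hFf : ∀ a : Fin I.n, F a = f a := fun a => by
    rw [hF a a.2, (posn_encode I pre a).2 0 (List.length_pos_iff.2 (hne a))]
    simp [f, List.head_eq_getElem]
  have hcnt : ∀ h : Fin I.m, cnt I.n F h = HouseInstance.load f h := cnt_eq_load hFf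
  have hSec : ∀ a : Fin I.n, I.cap (f a) < HouseInstance.load f (f a) →
      ((∀ k, ¬ I.IsSecond f a k) ∧ S a = F a) ∨
      ∃ k : Fin I.m, S a = k ∧ I.IsSecond f a k ∧ ∀ k', I.IsSecond f a k' → k' = k := by
    intro a ha
    refine isSecond_of_firstWith (pre := pre) (P := fun h => cnt I.n F h < capOf I h)
      (fun h => by rw [hcnt, hcap]) ?_
    have := hS' a a.2 (by rw [hFf, hcnt, hcap]; exact ha)
    rwa [lengthOf, dif_pos a.2] at this
  have hSec' : ∀ a : Fin I.n, S a = f a ∨ ∃ k : Fin I.m, S a = k ∧ I.IsSecond f a k := by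
    intro a
    by_cases ha : I.cap (f a) < HouseInstance.load f (f a)
    · rcases hSec a ha with ⟨-, h⟩ | ⟨k, h, h', -⟩
      · exact Or.inl (h.trans (hFf a))
      · exact Or.inr ⟨k, h, h'⟩
    · left
      rw [hS a a.2 (by rw [hFf, hcnt, hcap]; exact not_lt.1 ha), hFf]
  have hg : ∀ a : Fin I.n, ∃ k : Fin I.m, s 8 a = k ∧ (k = f a ∨ I.IsSecond f a k) := by
    intro a
    rcases hc.places a with ⟨h, -⟩ | ⟨h, -⟩
    · exact ⟨f a, h.trans (hFf a), Or.inl rfl⟩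
    · rcases hSec' a with h' | ⟨k, h', h''⟩
      · exact ⟨f a, h.trans h', Or.inl rfl⟩
      · exact ⟨k, h.trans h', Or.inr h''⟩
  choose g hg₁ hg₂ using hg
  have hload : ∀ h : Fin I.m, s 11 h = HouseInstance.load g h := fun h => by
    rw [hc.load_eq, cnt_eq_load hg₁]
  refine ⟨g, hg₁, hload, fun v hv => ?_, ?_, fun r hr => ?_⟩
  · rw [hc.load_eq, cnt, Finset.card_eq_zero, Finset.filter_eq_empty_iff]
    intro a ha e
    have := hg₁ ⟨a, Finset.mem_range.1 ha⟩
    simp only at this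
    have := (g ⟨a, Finset.mem_range.1 ha⟩).2
    omega
  · refine HouseInstance.isPopular_increase hf hg₂ fun h hh => ?_
    have := hc.ge h
    rw [hcap, hcnt, hload] at this
    exact this hh
  · obtain ⟨Z, hZ₁, hZ₂, hZ₃⟩ := ho
    -- The current and the alternative place are the first and the second house in some order, so
    -- closure under moves yields both.
    have hboth : ∀ a : Fin I.n, (g a : ℕ) ∈ Z → F a ∈ Z ∧ S a ∈ Z := by
      intro a ha
      rw [← hg₁] at ha
      have ha' := hZ₁ a ha
      rcases hc.places a with ⟨h, h'⟩ | ⟨h, h'⟩ <;> rw [h] at ha <;> rw [h'] at ha'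
      · exact ⟨ha, ha'⟩
      · exact ⟨ha', ha⟩
    refine HouseInstance.sum_le_of_isGoodIncrease hf
      (Finset.univ.filter fun h : Fin I.m => (h : ℕ) ∈ Z) (fun a ha => ?_) (fun a ha hl k hk => ?_)
      (fun h hh => ?_) (fun h hh => ?_) hr
    · rw [Finset.mem_filter] at ha ⊢
      rw [← hFf]
      exact ⟨Finset.mem_univ _, (hboth a ha.2).1⟩
    · rw [Finset.mem_filter] at ha ⊢
      refine ⟨Finset.mem_univ _, ?_⟩
      rcases hSec a hl with ⟨h, -⟩ | ⟨k', h₁, -, h₂⟩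
      · exact absurd hk (h k)
      · rw [h₂ k hk, ← h₁]
        exact (hboth a ha.2).2
    · refine Finset.mem_filter.2 ⟨Finset.mem_univ _, hZ₂ h ?_⟩
      rwa [hcap, hload]
    · have := hZ₃ h (Finset.mem_filter.1 hh).2
      rwa [hcap, hload] at this

/-! ### Output, and the two problems. -/

/-- Write the solution to the output. -/
def writeSolution : Code :=
  .cond (var 16) (.assign 1 (.const 0) (.const 0))
    (.seq (.rep 3 (.assign 1 (.add (.const 1) (var 3))
        (.sub (.get 11 (var 3)) (.get 6 (var 3)))))
      (.seq (.rep 3 (.assign 1 (.add (.add (.const 1) (.get 0 (.const 1))) (var 3))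
          (.get 8 (var 3))))
        (.assign 1 (.const 0) (.const 1))))

theorem den_writeSolution_of_empty (s : Memory) (h : s 16 0 ≠ 0) :
    writeSolution.den s 1 0 = 0 := by
  rw [writeSolution, Code.den, if_neg (by simpa using h)]
  simp [Code.den]

/-- The first loop makes n + m rounds and so overruns the m cells of the increase vector; the
surplus lands in cells that the second loop overwrites with the assignment. -/
theorem den_writeSolution (s : Memory) (h : s 16 0 = 0) :
    writeSolution.den s 1 0 = 1 ∧
    (∀ v < s 0 1, v < s 2 0 → writeSolution.den s 1 (1 + v) = s 11 v - s 6 v) ∧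
    ∀ a < s 2 0, writeSolution.den s 1 (1 + s 0 1 + a) = s 8 a := by
  rw [writeSolution, Code.den, if_pos (by simpa using h), Code.den, Code.den]
  have h₁ := Code.den_rep_induction (v := 3) s
    (p := .assign 1 (.add (.const 1) (var 3)) (.sub (.get 11 (var 3)) (.get 6 (var 3))))
    (fun i s' => ∀ v < i, s' 1 (1 + v) = s 11 v - s 6 v) (by omega) fun i hi s' hfr h3 ih v hv => by
      have h6 : s' 6 = s 6 := hfr 6 rfl
      have h11 : s' 11 = s 11 := hfr 11 rfl
      simp only [Memory.set_ne, Memory.set_same, ne_eq, OfNat.one_ne_ofNat, not_false_eq_true,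
        Code.den, eval_sub, eval_add, eval_get, eval_const, eval_var, h3, h6, h11]
      by_cases hvi : v = i
      · subst hvi; rw [Function.update_self]
      · rw [Function.update_of_ne (by omega)]
        exact ih v (by omega)
  set s₁ := (Code.rep 3 (.assign 1 (.add (.const 1) (var 3))
    (.sub (.get 11 (var 3)) (.get 6 (var 3))))).den s with hs₁
  have k0 : s₁ 0 = s 0 := Code.den_of_keeps rfl s
  have k2 : s₁ 2 = s 2 := Code.den_of_keeps rfl s
  have k8 : s₁ 8 = s 8 := Code.den_of_keeps rfl s
  have h₂ := Code.den_rep_induction (v := 3) s₁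
    (p := .assign 1 (.add (.add (.const 1) (.get 0 (.const 1))) (var 3)) (.get 8 (var 3)))
    (fun i s' => (∀ v < s 0 1, s' 1 (1 + v) = s₁ 1 (1 + v)) ∧
      ∀ a < i, s' 1 (1 + s 0 1 + a) = s 8 a) (by simp [Memory.set_ne])
    fun i hi s' hfr h3 ih => by
      have h0 : s' 0 = s 0 := (hfr 0 rfl).trans k0
      have h8 : s' 8 = s 8 := (hfr 8 rfl).trans k8
      simp only [Memory.set_ne, Memory.set_same, ne_eq, OfNat.one_ne_ofNat, not_false_eq_true,
        Code.den, eval_add, eval_get, eval_const, eval_var, h3, h0, h8]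
      refine ⟨fun v hv => ?_, fun a ha => ?_⟩
      · rw [Function.update_of_ne (by omega)]
        exact ih.1 v hv
      · by_cases hai : a = i
        · subst hai; rw [Function.update_self]
        · rw [Function.update_of_ne (by omega)]
          exact ih.2 a (by omega)
  set s₂ := (Code.rep 3 (.assign 1 (.add (.add (.const 1) (.get 0 (.const 1))) (var 3))
    (.get 8 (var 3)))).den s₁ with hs₂
  rw [k2] at h₂
  simp only [Code.den, eval_const, Memory.set_same, Function.update_self, true_and]
  refine ⟨fun v hv hvL => ?_, fun a ha => ?_⟩
  · rw [Function.update_of_ne (by omega), h₂.1 v hv, h₁ v hvL]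
  · rw [Function.update_of_ne (by omega), h₂.2 a ha]

/-- Compare the total of the capacity increases with the bound in the first word of the input. -/
def writeDecision : Code :=
  .cond (var 16) (.assign 1 (.const 0) (.const 0))
    (.seq (.assign 17 (.const 0) (.const 0))
      (.seq (.rep 3 (.assign 17 (.const 0)
          (.add (var 17) (.sub (.get 11 (var 3)) (.get 6 (var 3))))))
        (.assign 1 (.const 0) (.sub (.const 1) (.sub (var 17) (var 0))))))

theorem den_writeDecision_of_empty (s : Memory) (h : s 16 0 ≠ 0) :
    writeDecision.den s 1 0 = 0 := by
  rw [writeDecision, Code.den, if_neg (by simpa using h)]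
  simp [Code.den]

/-- With truncated subtraction, 1 - (total - k) is 1 if the total is at most k, and 0 otherwise. -/
theorem den_writeDecision (s : Memory) (h : s 16 0 = 0) :
    writeDecision.den s 1 0 = 1 - (excess (s 2 0) (s 6) (s 11) - s 0 0) := by
  rw [writeDecision, Code.den, if_pos (by simpa using h), Code.den, Code.den, Code.den]
  set s₀ := s.set 17 ((Expr.const 0).eval s) ((Expr.const 0).eval s) with hs₀
  have hfr₀ : ∀ b ≠ 17, s₀ b = s b := fun b hb => Memory.set_ne _ _ _ hb
  have h₁ := Code.den_rep_induction (v := 3) s₀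
    (p := .assign 17 (.const 0) (.add (var 17) (.sub (.get 11 (var 3)) (.get 6 (var 3)))))
    (fun i s' => s' 17 0 = excess i (s 6) (s 11)) (by simp [Memory.set_ne, excess, hs₀])
    fun i hi s' hfr h3 ih => by
      have h6 : s' 6 = s 6 := (hfr 6 rfl).trans (hfr₀ 6 (by norm_num))
      have h11 : s' 11 = s 11 := (hfr 11 rfl).trans (hfr₀ 11 (by norm_num))
      simp only [Memory.set_ne, Memory.set_same, ne_eq, Nat.reduceEqDiff, not_false_eq_true,
        Code.den, eval_add, eval_sub, eval_get, eval_const, eval_var, h3, h6, h11, ih,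
        Function.update_self, excess, Finset.sum_range_succ]
  rw [hfr₀ 2 (by norm_num)] at h₁
  have h0 : (Code.rep 3 (.assign 17 (.const 0)
      (.add (var 17) (.sub (.get 11 (var 3)) (.get 6 (var 3)))))).den s₀ 0 = s 0 :=
    (Code.den_of_keeps rfl s₀).trans (hfr₀ 0 (by norm_num))
  rw [Code.den, Memory.set_same]
  simp only [eval_sub, eval_const, eval_var, Function.update_self, h0, h₁]

theorem solve_empty (I : HouseInstance) (pre : List ℕ) :
    (solve pre.length).den (start pre.length (pre ++ I.encode)) 16 0 ≠ 0 ↔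
      ∃ a, I.pref a = [] := by
  rw [(den_solve (encodes I pre)).1]
  constructor
  · rintro ⟨a, ha, h⟩
    rw [lengthOf, dif_pos ha] at h
    exact ⟨⟨a, ha⟩, List.length_eq_zero_iff.1 h⟩
  · rintro ⟨a, h⟩
    refine ⟨a, a.2, ?_⟩
    rw [lengthOf, dif_pos a.2]
    exact List.length_eq_zero_iff.2 h

theorem solve_input (off : ℕ) (w : List ℕ) :
    (solve off).den (start off w) 0 = fun i => w.getD i 0 := by
  rw [Code.den_of_keeps rfl, start, Memory.set_ne _ _ _ (by norm_num)]
  funext i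
  simp [init]

theorem solve_length (I : HouseInstance) (pre : List ℕ) :
    (solve pre.length).den (start pre.length (pre ++ I.encode)) 2 0 = I.n + I.m := by
  rw [Code.den_of_keeps rfl, start, Memory.set_same, Function.update_self]
  exact congrArg₂ _ (encodes I pre).applicants (encodes I pre).houses

theorem sum_getD_le (I : HouseInstance) (pre : List ℕ) :
    (pre ++ I.encode).getD pre.length 0 + (pre ++ I.encode).getD (pre.length + 1) 0 ≤
      inputSize (pre ++ I.encode) := by
  refine le_of_eq_of_le ?_ (le_inputSize I pre)
  exact congrArg₂ _ (encodes I pre).applicants (encodes I pre).houses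

theorem polyTimeSolvable_minSum :
    PolyTimeSolvable HouseInstance.encode HouseInstance.IsMinSumSolution := by
  refine polyTimeSolvable_of_code (.seq (solve 0) writeSolution) rfl 0
    (fun I => sum_getD_le I []) fun I => ?_
  rw [Code.den]
  have hemp := solve_empty I []
  have hinp := solve_input 0 I.encode
  have hlen := solve_length I []
  have hsix := (den_solve (encodes I [])).2.1
  have hcor := solve_correct I []
  simp only [List.nil_append, List.length_nil] at hemp hlen hsix hcor
  by_cases he : ∃ a, I.pref a = []
  · obtain ⟨a, ha⟩ := he
    exact Or.inl ⟨HouseInstance.not_isGoodIncrease ha,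
      den_writeSolution_of_empty _ (hemp.2 ⟨a, ha⟩)⟩
  · obtain ⟨g, h₁, h₂, -, h₄, h₅⟩ := hcor fun a ha => he ⟨a, ha⟩
    have h16 := not_not.1 (mt hemp.1 he)
    generalize (solve 0).den (start 0 I.encode) = s at *
    obtain ⟨o₁, o₂, o₃⟩ := den_writeSolution s h16
    have hm : s 0 1 = I.m := by rw [hinp]; rfl
    rw [hm, hlen] at o₂
    rw [hm, hlen] at o₃
    refine Or.inr ⟨o₁, fun h => HouseInstance.load g h - I.cap h, g, fun h => ?_, fun a => ?_,
      h₄, h₅⟩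
    · rw [o₂ h h.2 (by omega), h₂, hsix]
      simp [capOf]
    · rw [o₃ a (by omega), h₁]

theorem polyTimeDecidable_minSumPopP :
    PolyTimeDecidable (fun x : HouseInstance × ℕ => x.2 :: x.1.encode)
      HouseInstance.MinSumPopP := by
  -- The offset is 1 because the bound k is the first input word.
  refine polyTimeSolvable_of_code (.seq (solve 1) writeDecision) rfl 1
    (fun x => sum_getD_le x.1 [x.2]) fun ⟨I, k⟩ => ?_
  rw [Code.den]
  have hemp := solve_empty I [k]
  have hinp := solve_input 1 (k :: I.encode)
  have hlen := solve_length I [k]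
  have hsix := (den_solve (encodes I [k])).2.1
  have hcor := solve_correct I [k]
  simp only [List.cons_append, List.nil_append, List.length_cons, List.length_nil,
    Nat.zero_add] at hemp hlen hsix hcor
  by_cases he : ∃ a, I.pref a = []
  · obtain ⟨a, ha⟩ := he
    refine ⟨fun ⟨r, _, hr⟩ => absurd hr (HouseInstance.not_isGoodIncrease ha r), fun _ => ?_⟩
    exact den_writeDecision_of_empty _ (hemp.2 ⟨a, ha⟩)
  · obtain ⟨g, h₁, h₂, h₃, h₄, h₅⟩ := hcor fun a ha => he ⟨a, ha⟩
    have h16 := not_not.1 (mt hemp.1 he)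
    simp only
    generalize (solve 1).den (start 1 (k :: I.encode)) = s at *
    have hk : s 0 0 = k := by rw [hinp]; rfl
    rw [den_writeDecision s h16, hk, hlen]
    have hex : excess (I.n + I.m) (s 6) (s 11) = ∑ h, (HouseInstance.load g h - I.cap h) := by
      have e : ∑ h : Fin I.m, (HouseInstance.load g h - I.cap h) =
          ∑ v ∈ Finset.range I.m, (s 11 v - s 6 v) := by
        rw [Finset.sum_range]
        refine Finset.sum_congr rfl fun h _ => ?_
        rw [h₂, hsix]
        simp [capOf]
      rw [e, excess]
      -- The program sums over n + m indices; those from m on carry no load and contribute nothing.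
      refine (Finset.sum_subset (Finset.range_subset_range.2 (by omega)) fun v _ hv => ?_).symm
      rw [h₃ v (by simpa using hv), Nat.zero_sub]
    rw [hex]
    constructor
    · rintro ⟨r, hr, hgood⟩
      have hle : ∑ h, (HouseInstance.load g h - I.cap h) ≤ k := (h₅ r hgood).trans hr
      omega
    · intro hno
      have : ¬ ∑ h, (HouseInstance.load g h - I.cap h) ≤ k := fun hle =>
        hno ⟨fun h => HouseInstance.load g h - I.cap h, hle, _, h₄, fun a => ⟨g a, rfl⟩⟩
      omega

end HouseProgram

theorem mainTheorem3 :
    RAM.PolyTimeDecidable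
        (fun x : HouseInstance × ℕ => x.2 :: x.1.encode) HouseInstance.MinSumPopP ∧
      RAM.PolyTimeSolvable HouseInstance.encode HouseInstance.IsMinSumSolution :=
  ⟨HouseProgram.polyTimeDecidable_minSumPopP, HouseProgram.polyTimeSolvable_minSum⟩
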